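/- All functions are (equivalence classes of) complex-valued measurable functions on $[0,1]$ with Lebesgue measure, and $f^*$, $(c_k^*)_{k\ge1}$ denote the non-increasing rearrangements of $|f|$ and of $(|c_n|)$. For $0<p,q\le\infty$ and $\beta\in\mathbb R$ (with $1/\infty=0$) let $L_{p,q}(\log L)_\beta$ and $l_{p,q}(\log l)_\beta$ be the spaces of those $f$ and those $(c_n)$ for which, respectively, $$\|f\|_{L_{p,q}(\log L)_\beta}=\big\|t^{1/p-1/q}(1+|\log t|)^\beta f^*(t)\big\|_{L_q(0,1)}<\infty,\qquad \|(c_n)\|_{l_{p,q}(\log l)_\beta}=\big\|\big(k^{1/p-1/q}(1+\log k)^\beta c_k^*\big)_{k\ge1}\big\|_{l_q}<\infty.$$ The intersection of two such spaces carries the maximum of the two quasi-norms. **Corollary 3.6.** Let $0<q\le\infty$ and $\alpha<-1/q$. There is a constant $C>0$ depending only on $q$ and $\alpha$ such that the following holds. Let $\{\varphi_n\}$ be an orthonormal system in $L_2(0,1)$, indexed by a countably infinite set (such as $\mathbb N$ or $\mathbb Z$), with $\sup_n\|\varphi_n\|_{L_\infty}=M<\infty$, and let $\mathcal F(f)=\{c_n(f)\}$,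 $c_n(f)=\int_0^1 f(x)\overline{\varphi_n(x)}\,dx$. Then every $f\in L_{2,q}(\log L)_{\alpha+1/\min(q,2)}$ is integrable, and $\mathcal F$ is bounded from $L_{2,q}(\log L)_{\alpha+1/\min(q,2)}$ into $l_{2,q}(\log l)_{\alpha+1/\max(q,2)}\cap l_{2,\max(q,2)}(\log l)_{\alpha+1/q}$ with $$\big\|\mathcal F : L_{2,q}(\log L)_{\alpha+1/\min(q,2)}\to l_{2,q}(\log l)_{\alpha+1/\max(q,2)}\cap l_{2,\max(q,2)}(\log l)_{\alpha+1/q}\big\|\le C\,\min\big(M,(1+\log M)^{|\alpha|}\big).$$ -/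

import Mathlib

open MeasureTheory Set
open scoped ENNReal NNReal

/-- Lebesgue measure on the interval `[0, 1]`. -/
noncomputable def unitVolume : Measure ℝ := volume.restrict (Icc (0 : ℝ) 1)

/-- The non-increasing rearrangement `f^*(t) = inf {s ≥ 0 : |{x ∈ [0,1] : |f x| > s}| ≤ t}` of
(the class of) a measurable function on `[0, 1]`. -/
noncomputable def funRearr (f : ℝ →ₘ[unitVolume] ℂ) (t : ℝ) : ℝ≥0∞ :=
  sInf {s : ℝ≥0∞ | unitVolume {x | s < ‖f x‖ₑ} ≤ ENNReal.ofReal t}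

/-- The non-increasing rearrangement of a family of complex numbers, for `k = 1, 2, …`:
`c_k^* = inf {s ≥ 0 : fewer than k indices n satisfy |c n| > s}`. -/
noncomputable def seqRearr {ι : Type} (c : ι → ℂ) (k : ℕ) : ℝ≥0∞ :=
  sInf {s : ℝ≥0∞ | {n | s < ‖c n‖ₑ}.encard < (k : ℕ∞)}

/-- The reciprocal of an exponent in `(0, ∞]`, as a real number; `1 / ∞ = 0`. -/
noncomputable def recip (q : ℝ≥0∞) : ℝ := (q⁻¹).toReal

/-- The quasi-norm of `L_{p,q}(log L)_α`, that is
`‖ t^{1/p - 1/q} (1 + |log t|)^α f^*(t) ‖` in `L_q(0, 1)` (it may be infinite). -/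
noncomputable def lzFunNorm (p q : ℝ≥0∞) (α : ℝ) (f : ℝ →ₘ[unitVolume] ℂ) : ℝ≥0∞ :=
  eLpNorm (fun t : ℝ => ENNReal.ofReal (t ^ (recip p - recip q) * (1 + |Real.log t|) ^ α)
    * funRearr f t) q (volume.restrict (Ioo (0 : ℝ) 1))

/-- The Lorentz–Zygmund function space `L_{p,q}(log L)_α`. -/
def LZFun (p q : ℝ≥0∞) (α : ℝ) : Set (ℝ →ₘ[unitVolume] ℂ) := {f | lzFunNorm p q α f < ∞}

/-- The quasi-norm of `l_{p,q}(log l)_α`, that is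
`‖ k^{1/p - 1/q} (1 + log k)^α c_k^* ‖` in `l_q`, `k = 1, 2, …` (it may be infinite);
the summation variable below is `j = k - 1`. -/
noncomputable def lzSeqNorm {ι : Type} (p q : ℝ≥0∞) (α : ℝ) (c : ι → ℂ) : ℝ≥0∞ :=
  eLpNorm (fun j : ℕ => ENNReal.ofReal (((j + 1 : ℕ) : ℝ) ^ (recip p - recip q)
    * (1 + Real.log ((j + 1 : ℕ) : ℝ)) ^ α) * seqRearr c (j + 1)) q Measure.count

/-- The Lorentz–Zygmund sequence space `l_{p,q}(log l)_α`. A family in it is automatically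
bounded, since `c_1^* = sup |c n|` carries a positive weight. -/
def LZSeq (ι : Type) (p q : ℝ≥0∞) (α : ℝ) : Set (ι → ℂ) := {c | lzSeqNorm p q α c < ∞}

/-- The Fourier series map `f ↦ (c_n(f))`, `c_n(f) = ∫_0^1 f(x) conj(φ_n(x)) dx`. -/
noncomputable def fourierMap {ι : Type} (φ : ι → Lp ℂ 2 unitVolume)
    (f : ℝ →ₘ[unitVolume] ℂ) : ι → ℂ :=
  fun n => ∫ x, f x * (starRingEnd ℂ) (φ n x) ∂unitVolume

/-!
The orthonormal system satisfies Bessel's inequality `‖ℱ f‖_{l²} ≤ ‖f‖_{L²}` and the trivial bound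
`‖ℱ f‖_{l^∞} ≤ M ‖f‖_{L¹}`. Both are applied to the pieces of a splitting of `f` at a level taken
from the dyadic samples `a m = 2^{-m/2} f^*(2^{-m-1})`: cutting at the `J`-th one,
`(∑_{k ≤ N} (c_k^*)²)^{1/2} ≤ (∑_{m < J} a_m²)^{1/2} + N^{1/2} M 2^{-J/4} ∑_m 2^{-m/4} a_m`.

Since `l_{2,q}(log l)` weights only see `log k`, it suffices to test the left side at
`N = 2^{2^{i+1}}`. If `M ≤ 2^{2^j}` with `2^j ≲ 1 + log M`, the choice `J ≈ 2^{i+j+4}` absorbs the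
factor `N^{1/2} M`, so the constant enters only as the shift `i ↦ i + j + 4` of the index; against
the weight `2^{i(α+1/q)}` this shift costs `2^{-(j+4)(α+1/q)} ≲ (1 + log M)^{|α+1/q|}`. What remains
is a Hardy inequality for the partial sums, which holds because `α + 1/q < 0`.
-/

section Recip

theorem recip_eq_one_div_toReal (q : ℝ≥0∞) : recip q = 1 / q.toReal := by
  rw [recip, ENNReal.toReal_inv, one_div]

theorem recip_nonneg (q : ℝ≥0∞) : 0 ≤ recip q := ENNReal.toReal_nonneg

theorem recip_two : recip 2 = 1 / 2 := by simp [recip]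

theorem recip_min_add_recip_max (p q : ℝ≥0∞) :
    recip (min p q) + recip (max p q) = recip p + recip q := by
  rcases le_total p q with h | h <;> simp [h, add_comm]

theorem two_rpow_ne_top (x : ℝ) : (2 : ℝ≥0∞) ^ x ≠ ∞ :=
  ENNReal.rpow_ne_top_of_ne_zero two_ne_zero ENNReal.ofNat_ne_top

theorem two_rpow_add (x y : ℝ) : (2 : ℝ≥0∞) ^ (x + y) = 2 ^ x * 2 ^ y :=
  ENNReal.rpow_add _ _ two_ne_zero ENNReal.ofNat_ne_top

theorem two_rpow_eq_ofReal (x : ℝ) : (2 : ℝ≥0∞) ^ x = ENNReal.ofReal (2 ^ x) := by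
  rw [← ENNReal.ofReal_rpow_of_pos two_pos, ENNReal.ofReal_ofNat]

end Recip

section ELpNorm

variable {α ε : Type*} [MeasurableSpace α] {μ : Measure α} {q : ℝ≥0∞}

theorem eLpNorm_sum_measure {ι : Type*} [Countable ι] [MeasurableSpace ι]
    [MeasurableSingletonClass ι] [ENorm ε] (f : α → ε) (q : ℝ≥0∞) (μ : ι → Measure α) :
    eLpNorm f q (Measure.sum μ) = eLpNorm (fun i => eLpNorm f q (μ i)) q Measure.count := by
  rcases eq_or_ne q 0 with rfl | h0
  · simp
  rcases eq_or_ne q ∞ with rfl | h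
  · simp only [eLpNorm_exponent_top, eLpNormEssSup, enorm_eq_self, essSup_count]
    refine le_antisymm (essSup_le_of_ae_le _ (Measure.ae_sum_iff.2 fun i => ?_)) ?_
    · filter_upwards [ENNReal.ae_le_essSup (μ := μ i) fun x => ‖f x‖ₑ] with x hx
      exact hx.trans (le_iSup (fun i => essSup (fun x => ‖f x‖ₑ) (μ i)) i)
    · exact iSup_le fun i =>
        essSup_mono_measure (Measure.absolutelyContinuous_of_le (Measure.le_sum μ i))
  · have hpos : q.toReal ≠ 0 := (ENNReal.toReal_pos h0 h).ne'
    simp only [eLpNorm_eq_lintegral_rpow_enorm_toReal h0 h, lintegral_sum_measure, lintegral_count,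
      enorm_eq_self, ← ENNReal.rpow_mul, one_div, inv_mul_cancel₀ hpos, ENNReal.rpow_one]

theorem eLpNorm_eq_eLpNorm_count_fiber [ENorm ε] {b : α → ℕ} (hb : Measurable b) (f : α → ε)
    (q : ℝ≥0∞) : eLpNorm f q μ =
      eLpNorm (fun r => eLpNorm f q (μ.restrict (b ⁻¹' {r}))) q Measure.count := by
  rw [← eLpNorm_sum_measure, ← Measure.restrict_iUnion
    (fun i j hij => (disjoint_singleton.2 hij).preimage b) fun r => hb (measurableSet_singleton r),
    ← preimage_iUnion, iUnion_of_singleton, preimage_univ, Measure.restrict_univ]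

theorem eLpNorm_restrict_biUnion_le [TopologicalSpace ε] [ContinuousENorm ε] (f : α → ε)
    (q : ℝ≥0∞) (s : ℕ → Set α) (I : Set ℕ) :
    eLpNorm f q (μ.restrict (⋃ i ∈ I, s i)) ≤
      eLpNorm (fun i => eLpNorm f q (μ.restrict (s i))) q (Measure.count.restrict I) := by
  calc eLpNorm f q (μ.restrict (⋃ i ∈ I, s i))
      ≤ eLpNorm (fun i => eLpNorm f q (μ.restrict (⋃ _ : i ∈ I, s i))) q Measure.count :=
        (eLpNorm_mono_measure f Measure.restrict_iUnion_le).trans_eq (eLpNorm_sum_measure f q _)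
    _ = eLpNorm (I.indicator fun i => eLpNorm f q (μ.restrict (s i))) q Measure.count := by
        congr 1 with i
        by_cases hi : i ∈ I <;> simp [hi]
    _ = _ := eLpNorm_indicator_eq_eLpNorm_restrict .of_discrete

theorem eLpNorm_count_comm (q : ℝ≥0∞) (x : ℕ → ℕ → ℝ≥0∞) :
    eLpNorm (fun i => eLpNorm (fun j => x i j) q Measure.count) q Measure.count =
      eLpNorm (fun j => eLpNorm (fun i => x i j) q Measure.count) q Measure.count := by
  rcases eq_or_ne q 0 with rfl | h0
  · simp
  rcases eq_or_ne q ∞ with rfl | h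
  · simpa only [eLpNorm_exponent_top, eLpNormEssSup, enorm_eq_self, essSup_count] using iSup_comm
  · have hpos : q.toReal ≠ 0 := (ENNReal.toReal_pos h0 h).ne'
    simp only [eLpNorm_eq_lintegral_rpow_enorm_toReal h0 h, lintegral_count,
      enorm_eq_self, ← ENNReal.rpow_mul, one_div, inv_mul_cancel₀ hpos, ENNReal.rpow_one]
    rw [ENNReal.tsum_comm]

theorem eLpNorm_comp_count_of_injective {g : ℕ → ℕ} (hg : g.Injective) (x : ℕ → ℝ≥0∞)
    (q : ℝ≥0∞) :
    eLpNorm (fun i => x (g i)) q Measure.count =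
      eLpNorm x q (Measure.count.restrict (range g)) := by
  have hmap : Measure.map g Measure.count = Measure.count.restrict (range g) := by
    ext s hs
    rw [Measure.map_apply .of_discrete hs, Measure.restrict_apply hs,
      Measure.count_apply .of_discrete, Measure.count_apply .of_discrete,
      ← image_preimage_eq_inter_range, hg.encard_image]
  rw [← hmap, eLpNorm_map_measure Measurable.of_discrete.aestronglyMeasurable
    Measurable.of_discrete.aemeasurable]
  rfl

theorem eLpNorm_le_mul_of_le_mul {μ : Measure ℕ} {x y : ℕ → ℝ≥0∞} {c : ℝ≥0∞}
    (h : ∀ i, x i ≤ c * y i) (q : ℝ≥0∞) : eLpNorm x q μ ≤ c * eLpNorm y q μ :=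
  eLpNorm_le_mul_eLpNorm_of_ae_le_mul'' q Measurable.of_discrete.aestronglyMeasurable
    (.of_forall h)

theorem eLpNorm_le_of_eLpNorm_top_le [TopologicalSpace ε] [ContinuousENorm ε] {p : ℝ≥0∞}
    (hp : p ≠ 0) (hq : q ≠ 0) {f : α → ε} (hf : AEStronglyMeasurable f μ) {A : ℝ≥0∞}
    (hfp : eLpNorm f p μ ≤ A) (hf_top : eLpNorm f ∞ μ ≤ A) :
    eLpNorm f q μ ≤ A * μ univ ^ (recip (min p q) - recip p) := by
  rcases le_total q p with hqp | hpq
  · rw [min_eq_right hqp, recip_eq_one_div_toReal, recip_eq_one_div_toReal]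
    exact (eLpNorm_le_eLpNorm_mul_rpow_measure_univ hqp hf).trans (mul_le_mul_left hfp _)
  rw [min_eq_left hpq, sub_self, ENNReal.rpow_zero, mul_one]
  rcases eq_or_ne q ∞ with rfl | hq_top
  · exact hf_top
  have hp_top : p ≠ ∞ := ne_top_of_le_ne_top hq_top hpq
  have hpos : 0 < q.toReal := ENNReal.toReal_pos hq hq_top
  have hle : 0 ≤ q.toReal - p.toReal := sub_nonneg.2 (ENNReal.toReal_mono hq_top hpq)
  rw [eLpNorm_eq_lintegral_rpow_enorm_toReal hp hp_top, one_div,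
    ENNReal.rpow_inv_le_iff (ENNReal.toReal_pos hp hp_top)] at hfp
  rw [eLpNorm_eq_lintegral_rpow_enorm_toReal hq hq_top, one_div, ENNReal.rpow_inv_le_iff hpos]
  calc ∫⁻ x, ‖f x‖ₑ ^ q.toReal ∂μ
      = ∫⁻ x, ‖f x‖ₑ ^ (q.toReal - p.toReal) * ‖f x‖ₑ ^ p.toReal ∂μ := by
        simp_rw [← ENNReal.rpow_add_of_nonneg _ _ hle ENNReal.toReal_nonneg, sub_add_cancel]
    _ ≤ ∫⁻ x, A ^ (q.toReal - p.toReal) * ‖f x‖ₑ ^ p.toReal ∂μ := by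
        refine lintegral_mono_ae ?_
        filter_upwards [enorm_ae_le_eLpNormEssSup f μ] with x hx
        gcongr
        exact hx.trans (by simpa using hf_top)
    _ = A ^ (q.toReal - p.toReal) * ∫⁻ x, ‖f x‖ₑ ^ p.toReal ∂μ :=
        lintegral_const_mul'' _ (hf.enorm.pow_const _)
    _ ≤ A ^ (q.toReal - p.toReal) * A ^ p.toReal := by gcongr
    _ = A ^ q.toReal := by
        rw [← ENNReal.rpow_add_of_nonneg _ _ hle ENNReal.toReal_nonneg, sub_add_cancel]

theorem eLpNorm_top_count_restrict_le (hq : q ≠ 0) (x : ℕ → ℝ≥0∞) (s : Set ℕ) :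
    eLpNorm x ∞ (Measure.count.restrict s) ≤ eLpNorm x q (Measure.count.restrict s) := by
  rw [← eLpNorm_indicator_eq_eLpNorm_restrict .of_discrete,
    ← eLpNorm_indicator_eq_eLpNorm_restrict .of_discrete, eLpNorm_exponent_top, eLpNormEssSup,
    essSup_count]
  exact iSup_le fun i => enorm_le_eLpNorm_count _ i hq

theorem eLpNorm_count_restrict_le_of_le {p : ℝ≥0∞} (hp : p ≠ 0) (hpq : p ≤ q) (x : ℕ → ℝ≥0∞)
    (s : Set ℕ) :
    eLpNorm x q (Measure.count.restrict s) ≤ eLpNorm x p (Measure.count.restrict s) := by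
  simpa [min_eq_left hpq] using
    eLpNorm_le_of_eLpNorm_top_le hp (hp.bot_lt.trans_le hpq).ne'
      Measurable.of_discrete.aestronglyMeasurable le_rfl (eLpNorm_top_count_restrict_le hp x s)

end ELpNorm

section Hardy

variable {q θ : ℝ≥0∞}

theorem eLpNorm_geometric_ne_top (hq : q ≠ 0) (hθ : θ < 1) :
    eLpNorm (fun n : ℕ => θ ^ n) q Measure.count ≠ ∞ := by
  rcases eq_or_ne q ∞ with rfl | h
  · rw [eLpNorm_exponent_top, eLpNormEssSup, essSup_count]
    exact ne_top_of_le_ne_top ENNReal.one_ne_top (iSup_le fun n => pow_le_one' hθ.le n)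
  · have hpos : 0 < q.toReal := ENNReal.toReal_pos hq h
    simp only [eLpNorm_eq_lintegral_rpow_enorm_toReal hq h, lintegral_count, enorm_eq_self,
      ← ENNReal.rpow_natCast_mul, mul_comm _ q.toReal, ENNReal.rpow_mul_natCast,
      ENNReal.tsum_geometric]
    refine ENNReal.rpow_ne_top_of_nonneg (by positivity) (ENNReal.inv_ne_top.2 ?_)
    exact (tsub_pos_of_lt (ENNReal.rpow_lt_one hθ hpos)).ne'

theorem eLpNorm_shifted_geometric (ρ a q : ℝ≥0∞) (r : ℕ) :
    eLpNorm (fun i => if r ≤ i then ρ ^ (i - r) * a else 0) q Measure.count =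
      eLpNorm (fun n => ρ ^ n * a) q Measure.count := by
  have hrange : Function.support (fun i => if r ≤ i then ρ ^ (i - r) * a else 0) ⊆
      range (r + ·) := fun i hi => by
    obtain ⟨n, rfl⟩ := le_iff_exists_add.1 (by_contra fun h => hi (if_neg h) : r ≤ i)
    exact mem_range_self n
  rw [← eLpNorm_restrict_eq_of_support_subset hrange,
    ← eLpNorm_comp_count_of_injective (add_right_injective r)]
  simp

/-- The square root of the kernel gives summability, the other half an `ℓ^q` bound
that does not require the triangle inequality, so that `q < 1` is allowed. -/
theorem exists_eLpNorm_geometric_conv_le (hq : q ≠ 0) (hθ : θ < 1) :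
    ∃ C ≠ ∞, ∀ z : ℕ → ℝ≥0∞,
      eLpNorm (fun i => ∑ r ∈ Finset.range (i + 1), θ ^ (i - r) * z r) q Measure.count ≤
        C * eLpNorm z q Measure.count := by
  set ρ : ℝ≥0∞ := θ ^ (1 / 2 : ℝ)
  have hρ : ρ < 1 := ENNReal.rpow_lt_one hθ (by norm_num)
  have hρθ : ρ * ρ = θ := by
    rw [← ENNReal.rpow_add_of_nonneg _ _ (by norm_num) (by norm_num), add_halves,
      ENNReal.rpow_one]
  set S : ℝ≥0∞ := (1 - ρ)⁻¹
  set R : ℝ≥0∞ := eLpNorm (fun n : ℕ => ρ ^ n) q Measure.count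
  refine ⟨S * R, ENNReal.mul_ne_top (ENNReal.inv_ne_top.2 (tsub_pos_of_lt hρ).ne')
    (eLpNorm_geometric_ne_top hq hρ), fun z => ?_⟩
  set u : ℕ → ℕ → ℝ≥0∞ := fun i r => if r ≤ i then ρ ^ (i - r) * z r else 0
  have hconv (i : ℕ) : ∑ r ∈ Finset.range (i + 1), θ ^ (i - r) * z r ≤
      S * eLpNorm (u i) q Measure.count := by
    calc ∑ r ∈ Finset.range (i + 1), θ ^ (i - r) * z r
        ≤ ∑ r ∈ Finset.range (i + 1), ρ ^ (i - r) * eLpNorm (u i) q Measure.count := by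
          refine Finset.sum_le_sum fun r hr => ?_
          rw [← hρθ, mul_pow, mul_assoc]
          gcongr
          simpa [u, Nat.lt_succ_iff.1 (Finset.mem_range.1 hr)] using
            enorm_le_eLpNorm_count (u i) r hq
      _ = (∑ n ∈ Finset.range (i + 1), ρ ^ n) * eLpNorm (u i) q Measure.count := by
          rw [← Finset.sum_mul, Finset.sum_flip]
      _ ≤ S * eLpNorm (u i) q Measure.count := by
          gcongr
          exact (ENNReal.sum_le_tsum _).trans_eq (ENNReal.tsum_geometric ρ)
  calc eLpNorm (fun i => ∑ r ∈ Finset.range (i + 1), θ ^ (i - r) * z r) q Measure.count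
      ≤ S * eLpNorm (fun i => eLpNorm (u i) q Measure.count) q Measure.count :=
        eLpNorm_le_mul_of_le_mul hconv q
    _ = S * eLpNorm (fun r => eLpNorm (fun n => ρ ^ n * z r) q Measure.count) q
          Measure.count := by
        rw [eLpNorm_count_comm]
        congr with r
        exact eLpNorm_shifted_geometric ρ (z r) q r
    _ ≤ S * (R * eLpNorm z q Measure.count) := by
        gcongr
        refine eLpNorm_le_mul_of_le_mul (fun r => ?_) q
        rw [mul_comm R]
        exact eLpNorm_le_mul_of_le_mul (fun n => (mul_comm _ _).le) q
    _ = S * R * eLpNorm z q Measure.count := (mul_assoc _ _ _).symm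

theorem exists_eLpNorm_two_rpow_mul_sum_le (hq : q ≠ 0) {β : ℝ} (hβ : β < 0) :
    ∃ C ≠ ∞, ∀ x : ℕ → ℝ≥0∞,
      eLpNorm (fun i : ℕ => 2 ^ (i * β) * ∑ r ∈ Finset.range i, x r) q Measure.count ≤
        C * eLpNorm (fun r : ℕ => 2 ^ (r * β) * x r) q Measure.count := by
  obtain ⟨C, hC, h⟩ := exists_eLpNorm_geometric_conv_le hq
    (ENNReal.rpow_lt_one_of_one_lt_of_neg ENNReal.one_lt_two hβ)
  refine ⟨C, hC, fun x => (eLpNorm_mono_enorm fun i => ?_).trans (h _)⟩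
  simp only [enorm_eq_self, Finset.mul_sum]
  refine (Finset.sum_le_sum fun r hr => ?_).trans
    (Finset.sum_le_sum_of_subset (Finset.range_mono i.le_succ))
  rw [← mul_assoc, ← ENNReal.rpow_mul_natCast, ← two_rpow_add,
    Nat.cast_sub (Finset.mem_range.1 hr).le]
  apply le_of_eq
  ring_nf

end Hardy

section DyadicBlock

theorem ofReal_rpow_le_of_comparable {x y K : ℝ} (hx : 0 < x) (hy : 0 < y) (hK : 0 < K)
    (hxy : x ≤ K * y) (hyx : y ≤ K * x) (γ : ℝ) :
    ENNReal.ofReal (x ^ γ) ≤ ENNReal.ofReal (K ^ |γ|) * ENNReal.ofReal (y ^ γ) := by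
  rw [← ENNReal.ofReal_mul (by positivity)]
  refine ENNReal.ofReal_le_ofReal ?_
  rcases le_or_gt 0 γ with hγ | hγ
  · rw [abs_of_nonneg hγ, ← Real.mul_rpow hK.le hy.le]
    exact Real.rpow_le_rpow hx.le hxy hγ
  · rw [abs_of_neg hγ, Real.rpow_neg hK.le, ← Real.inv_rpow hK.le,
      ← Real.mul_rpow (by positivity) hy.le]
    exact Real.rpow_le_rpow_of_nonpos (by positivity) (by rwa [inv_mul_le_iff₀ hK]) hγ.le

/-- The `ℓ^q` norm of `((m + 1)^γ a_m)`: with `m ≈ |log₂ t|`, it is the discrete form of the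
quasi-norm of `L_{2,q}(log L)_γ`. -/
noncomputable def weightedNorm (q : ℝ≥0∞) (γ : ℝ) (a : ℕ → ℝ≥0∞) : ℝ≥0∞ :=
  eLpNorm (fun m : ℕ => ENNReal.ofReal (((m : ℝ) + 1) ^ γ) * a m) q Measure.count

/-- The block `{2^r - 1, …, 2^(r + 1) - 2}` of indices `m`, on which `m + 1 ≈ 2^r`. -/
def dyadicBlock (r : ℕ) : Set ℕ := (fun m => Nat.log 2 (m + 1)) ⁻¹' {r}

theorem mem_dyadicBlock {r m : ℕ} : m ∈ dyadicBlock r ↔ 2 ^ r ≤ m + 1 ∧ m + 1 < 2 ^ (r + 1) :=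
  Nat.log_eq_iff (.inr ⟨one_lt_two, m.succ_ne_zero⟩)

theorem count_dyadicBlock_le (r : ℕ) : Measure.count (dyadicBlock r) ≤ 2 ^ (r : ℝ) := by
  have hsub : dyadicBlock r ⊆ Finset.Ico (2 ^ r - 1) (2 ^ (r + 1) - 1) := fun m hm => by
    have := mem_dyadicBlock.1 hm
    simp only [Finset.coe_Ico, mem_Ico]
    omega
  refine (measure_mono hsub).trans ?_
  rw [Measure.count_apply_finset, Nat.card_Ico, ENNReal.rpow_natCast]
  exact_mod_cast (show 2 ^ (r + 1) - 1 - (2 ^ r - 1) ≤ 2 ^ r by rw [pow_succ]; omega)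

theorem two_rpow_le_on_dyadicBlock (γ : ℝ) {r m : ℕ} (hm : m ∈ dyadicBlock r) :
    (2 : ℝ≥0∞) ^ (r * γ) ≤ ENNReal.ofReal (2 ^ |γ|) * ENNReal.ofReal (((m : ℝ) + 1) ^ γ) := by
  obtain ⟨h₁, h₂⟩ := mem_dyadicBlock.1 hm
  have h₁' : (2 : ℝ) ^ r ≤ m + 1 := by exact_mod_cast h₁
  have h₂' : (m : ℝ) + 1 ≤ 2 * 2 ^ r := by
    rw [← pow_succ']
    exact_mod_cast h₂.le
  rw [two_rpow_eq_ofReal, Real.rpow_mul two_pos.le, Real.rpow_natCast]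
  exact ofReal_rpow_le_of_comparable (by positivity) (by positivity) two_pos (by linarith) h₂' γ

theorem two_rpow_mul_eLpNorm_two_dyadicBlock_le {q : ℝ≥0∞} (hq : q ≠ 0) (α : ℝ)
    (a : ℕ → ℝ≥0∞) (r : ℕ) :
    2 ^ (r * (α + recip q)) * eLpNorm a 2 (Measure.count.restrict (dyadicBlock r)) ≤
      ENNReal.ofReal (2 ^ |α + recip (min q 2)|) *
        eLpNorm (fun m : ℕ => ENNReal.ofReal (((m : ℝ) + 1) ^ (α + recip (min q 2))) * a m) q
          (Measure.count.restrict (dyadicBlock r)) := by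
  set γ := α + recip (min q 2) with hγ
  set ν := Measure.count.restrict (dyadicBlock r)
  have hexp : 0 ≤ recip (min q 2) - recip q := sub_nonneg.2 <|
    ENNReal.toReal_mono (by simp [hq]) (ENNReal.inv_le_inv.2 (min_le_left q 2))
  have hcard : ν univ ≤ 2 ^ (r : ℝ) := by
    simpa only [ν, Measure.restrict_apply_univ] using count_dyadicBlock_le r
  calc 2 ^ (r * (α + recip q)) * eLpNorm a 2 ν
      ≤ 2 ^ (r * (α + recip q)) *
          (eLpNorm a q ν * (2 ^ (r : ℝ)) ^ (recip (min q 2) - recip q)) := by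
        gcongr
        exact (eLpNorm_le_of_eLpNorm_top_le hq two_ne_zero
          Measurable.of_discrete.aestronglyMeasurable le_rfl
          (eLpNorm_top_count_restrict_le hq a _)).trans (by gcongr)
    _ = 2 ^ (r * γ) * eLpNorm a q ν := by
        rw [← ENNReal.rpow_mul, ← mul_assoc, mul_right_comm, ← two_rpow_add, hγ]
        ring_nf
    _ ≤ 2 ^ (r * γ) * (2 ^ (-(r * γ)) * ENNReal.ofReal (2 ^ |γ|) *
          eLpNorm (fun m : ℕ => ENNReal.ofReal (((m : ℝ) + 1) ^ γ) * a m) q ν) := by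
        gcongr
        refine eLpNorm_le_mul_eLpNorm_of_ae_le_mul'' q
          Measurable.of_discrete.aestronglyMeasurable ?_
        filter_upwards [ae_restrict_mem .of_discrete] with m hm
        calc a m = 2 ^ (-(r * γ)) * 2 ^ (r * γ) * a m := by rw [← two_rpow_add]; simp
          _ ≤ 2 ^ (-(r * γ)) *
                (ENNReal.ofReal (2 ^ |γ|) * ENNReal.ofReal (((m : ℝ) + 1) ^ γ)) * a m := by
              gcongr
              exact two_rpow_le_on_dyadicBlock γ hm
          _ = _ := by simp only [enorm_eq_self]; ring
    _ = _ := by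
        rw [← mul_assoc, ← mul_assoc, ← two_rpow_add]
        simp

theorem eLpNorm_two_initial_le_sum (a : ℕ → ℝ≥0∞) (i : ℕ) :
    eLpNorm a 2 (Measure.count.restrict (Iio (2 ^ i - 1))) ≤
      ∑ r ∈ Finset.range i, eLpNorm a 2 (Measure.count.restrict (dyadicBlock r)) := by
  have hsub : Iio (2 ^ i - 1) ⊆ ⋃ r ∈ Iio i, dyadicBlock r := fun m hm => by
    have : m < 2 ^ i - 1 := hm
    exact mem_iUnion₂.2 ⟨_, Nat.log_lt_of_lt_pow m.succ_ne_zero (by omega), rfl⟩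
  calc eLpNorm a 2 (Measure.count.restrict (Iio (2 ^ i - 1)))
      ≤ eLpNorm a 2 (Measure.count.restrict (⋃ r ∈ Iio i, dyadicBlock r)) :=
        eLpNorm_mono_measure a (Measure.restrict_mono hsub le_rfl)
    _ ≤ eLpNorm (fun r => eLpNorm a 2 (Measure.count.restrict (dyadicBlock r))) 2
          (Measure.count.restrict (Iio i)) := eLpNorm_restrict_biUnion_le _ _ _ _
    _ ≤ eLpNorm (fun r => eLpNorm a 2 (Measure.count.restrict (dyadicBlock r))) 1
          (Measure.count.restrict (Iio i)) :=
        eLpNorm_count_restrict_le_of_le one_ne_zero one_le_two _ _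
    _ = _ := by
        rw [eLpNorm_one_eq_lintegral_enorm, ← Finset.coe_range, lintegral_finset]
        simp

theorem exists_eLpNorm_two_initial_le {q : ℝ≥0∞} (hq : q ≠ 0) {α : ℝ} (hα : α + recip q < 0) :
    ∃ C ≠ ∞, ∀ a : ℕ → ℝ≥0∞,
      eLpNorm (fun i : ℕ => 2 ^ (i * (α + recip q)) *
        eLpNorm a 2 (Measure.count.restrict (Iio (2 ^ i - 1)))) q Measure.count ≤
          C * weightedNorm q (α + recip (min q 2)) a := by
  obtain ⟨C, hC, h⟩ := exists_eLpNorm_two_rpow_mul_sum_le hq hα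
  refine ⟨C * ENNReal.ofReal (2 ^ |α + recip (min q 2)|),
    ENNReal.mul_ne_top hC ENNReal.ofReal_ne_top, fun a => ?_⟩
  have hblocks : weightedNorm q (α + recip (min q 2)) a = eLpNorm (fun r => eLpNorm
      (fun m : ℕ => ENNReal.ofReal (((m : ℝ) + 1) ^ (α + recip (min q 2))) * a m) q
        (Measure.count.restrict (dyadicBlock r))) q Measure.count :=
    eLpNorm_eq_eLpNorm_count_fiber .of_discrete _ q
  calc eLpNorm (fun i : ℕ => 2 ^ (i * (α + recip q)) *
        eLpNorm a 2 (Measure.count.restrict (Iio (2 ^ i - 1)))) q Measure.count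
      ≤ eLpNorm (fun i : ℕ => 2 ^ (i * (α + recip q)) * ∑ r ∈ Finset.range i,
          eLpNorm a 2 (Measure.count.restrict (dyadicBlock r))) q Measure.count := by
        refine eLpNorm_mono_enorm fun i => ?_
        simp only [enorm_eq_self]
        gcongr
        exact eLpNorm_two_initial_le_sum a i
    _ ≤ C * eLpNorm (fun r : ℕ => 2 ^ (r * (α + recip q)) *
          eLpNorm a 2 (Measure.count.restrict (dyadicBlock r))) q Measure.count := h _
    _ ≤ C * (ENNReal.ofReal (2 ^ |α + recip (min q 2)|) *
          weightedNorm q (α + recip (min q 2)) a) := by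
        gcongr
        rw [hblocks]
        exact eLpNorm_le_mul_of_le_mul (two_rpow_mul_eLpNorm_two_dyadicBlock_le hq α a) q
    _ = _ := (mul_assoc _ _ _).symm

theorem tsum_two_rpow_mul_rpow_ne_top {b : ℝ} (hb : b < 0) (γ : ℝ) :
    ∑' m : ℕ, (2 : ℝ≥0∞) ^ (m * b) * ENNReal.ofReal (((m : ℝ) + 1) ^ γ) ≠ ∞ := by
  obtain ⟨k, hk⟩ := exists_nat_ge γ
  set r : ℝ := 2 ^ b with hr
  have hr0 : 0 < r := by positivity
  have hr1 : r < 1 := Real.rpow_lt_one_of_one_lt_of_neg one_lt_two hb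
  have hs : Summable fun m : ℕ => r⁻¹ * (((m + 1 : ℕ) : ℝ) ^ k * r ^ (m + 1)) :=
    ((summable_nat_add_iff (f := fun m : ℕ => (m : ℝ) ^ k * r ^ m) 1).2
      (summable_pow_mul_geometric_of_norm_lt_one k
        (by rwa [Real.norm_of_nonneg hr0.le]))).mul_left r⁻¹
  refine ne_top_of_le_ne_top hs.tsum_ofReal_ne_top (ENNReal.tsum_le_tsum fun m => ?_)
  rw [two_rpow_eq_ofReal, ← ENNReal.ofReal_mul (by positivity)]
  refine ENNReal.ofReal_le_ofReal ?_
  calc (2 : ℝ) ^ (m * b) * ((m : ℝ) + 1) ^ γ ≤ r ^ m * ((m : ℝ) + 1) ^ (k : ℝ) := by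
        rw [hr, ← Real.rpow_mul_natCast two_pos.le, mul_comm b]
        gcongr
        linarith [m.cast_nonneg (α := ℝ)]
    _ = r⁻¹ * (((m + 1 : ℕ) : ℝ) ^ k * r ^ (m + 1)) := by
        rw [Real.rpow_natCast, pow_succ r]
        push_cast
        field_simp

theorem exists_tsum_two_rpow_mul_le {q : ℝ≥0∞} (hq : q ≠ 0) {b : ℝ} (hb : b < 0) (γ : ℝ) :
    ∃ C ≠ ∞, ∀ a : ℕ → ℝ≥0∞, ∑' m : ℕ, 2 ^ (m * b) * a m ≤ C * weightedNorm q γ a := by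
  refine ⟨_, tsum_two_rpow_mul_rpow_ne_top hb (-γ), fun a => ?_⟩
  rw [← ENNReal.tsum_mul_right]
  refine ENNReal.tsum_le_tsum fun m => ?_
  rw [mul_assoc]
  gcongr
  have hm : (0 : ℝ) < m + 1 := by positivity
  calc a m = ENNReal.ofReal (((m : ℝ) + 1) ^ (-γ)) *
        (ENNReal.ofReal (((m : ℝ) + 1) ^ γ) * a m) := by
        rw [← mul_assoc, ← ENNReal.ofReal_mul (by positivity), ← Real.rpow_add hm]
        simp
    _ ≤ ENNReal.ofReal (((m : ℝ) + 1) ^ (-γ)) * weightedNorm q γ a := by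
        gcongr
        exact enorm_le_eLpNorm_count
          (fun m : ℕ => ENNReal.ofReal (((m : ℝ) + 1) ^ γ) * a m) m hq

theorem exists_eLpNorm_two_initial_add_le {q : ℝ≥0∞} (hq : q ≠ 0) {α : ℝ} (hα : α + recip q < 0)
    {b : ℝ} (hb : b < 0) :
    ∃ C ≠ ∞, ∀ a : ℕ → ℝ≥0∞,
      eLpNorm (fun i : ℕ => 2 ^ (i * (α + recip q)) *
        (eLpNorm a 2 (Measure.count.restrict (Iio (2 ^ i - 1))) + ∑' m : ℕ, 2 ^ (m * b) * a m))
          q Measure.count ≤ C * weightedNorm q (α + recip (min q 2)) a := by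
  obtain ⟨C₁, hC₁, h₁⟩ := exists_eLpNorm_two_initial_le hq hα
  obtain ⟨C₂, hC₂, h₂⟩ := exists_tsum_two_rpow_mul_le hq hb (α + recip (min q 2))
  set G := eLpNorm (fun i : ℕ => (2 : ℝ≥0∞) ^ (i * (α + recip q))) q Measure.count with hGdef
  have hG : G ≠ ∞ := by
    simp_rw [hGdef, mul_comm _ (α + recip q), ENNReal.rpow_mul, ENNReal.rpow_natCast]
    exact eLpNorm_geometric_ne_top hq
      (ENNReal.rpow_lt_one_of_one_lt_of_neg ENNReal.one_lt_two hα)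
  refine ⟨ENNReal.LpAddConst q * (C₁ + C₂ * G), ENNReal.mul_ne_top
    (ENNReal.LpAddConst_lt_top q).ne (ENNReal.add_ne_top.2 ⟨hC₁, ENNReal.mul_ne_top hC₂ hG⟩),
    fun a => ?_⟩
  set Z := ∑' m : ℕ, 2 ^ (m * b) * a m
  calc eLpNorm (fun i : ℕ => 2 ^ (i * (α + recip q)) *
        (eLpNorm a 2 (Measure.count.restrict (Iio (2 ^ i - 1))) + Z)) q Measure.count
      = eLpNorm ((fun i : ℕ => 2 ^ (i * (α + recip q)) *
          eLpNorm a 2 (Measure.count.restrict (Iio (2 ^ i - 1)))) +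
          fun i : ℕ => 2 ^ (i * (α + recip q)) * Z) q Measure.count := by
        congr 1
        exact funext fun i => mul_add _ _ _
    _ ≤ ENNReal.LpAddConst q * (C₁ * weightedNorm q (α + recip (min q 2)) a + Z * G) := by
        refine (eLpNorm_add_le' Measurable.of_discrete.aestronglyMeasurable
          Measurable.of_discrete.aestronglyMeasurable q).trans ?_
        gcongr
        · exact h₁ a
        · exact eLpNorm_le_mul_of_le_mul (fun i => (mul_comm _ _).le) q
    _ ≤ ENNReal.LpAddConst q * (C₁ * weightedNorm q (α + recip (min q 2)) a +
          C₂ * weightedNorm q (α + recip (min q 2)) a * G) := by gcongr; exact h₂ a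
    _ = ENNReal.LpAddConst q * (C₁ + C₂ * G) * weightedNorm q (α + recip (min q 2)) a := by ring

theorem eLpNorm_two_rpow_mul_comp_add_le (u : ℕ → ℝ≥0∞) (s : ℕ) (b : ℝ) (q : ℝ≥0∞) :
    eLpNorm (fun i : ℕ => 2 ^ (i * b) * u (i + s)) q Measure.count ≤
      2 ^ (-(s * b)) * eLpNorm (fun i : ℕ => 2 ^ (i * b) * u i) q Measure.count := by
  calc eLpNorm (fun i : ℕ => 2 ^ (i * b) * u (i + s)) q Measure.count
      ≤ 2 ^ (-(s * b)) * eLpNorm (fun i : ℕ => 2 ^ ((i + s : ℕ) * b) * u (i + s)) q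
          Measure.count := by
        refine eLpNorm_le_mul_of_le_mul (fun i => ?_) q
        rw [← mul_assoc, ← two_rpow_add]
        gcongr
        · exact one_le_two
        · push_cast; linarith
    _ ≤ 2 ^ (-(s * b)) * eLpNorm (fun i : ℕ => 2 ^ (i * b) * u i) q Measure.count := by
        gcongr
        rw [eLpNorm_comp_count_of_injective (add_left_injective s)
          (fun i : ℕ => 2 ^ (i * b) * u i)]
        exact eLpNorm_mono_measure _ Measure.restrict_le_self

end DyadicBlock

section LorentzZygmundSequence

theorem seqRearr_antitone {ι : Type} (c : ι → ℂ) : Antitone (seqRearr c) := fun _ _ hst =>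
  sInf_le_sInf fun _ hu => lt_of_lt_of_le (α := ℕ∞) hu (by exact_mod_cast hst)

theorem eLpNorm_withDensity {α : Type*} [MeasurableSpace α] {μ : Measure α} {w f : α → ℝ≥0∞}
    (hw : Measurable w) (hw0 : ∀ x, w x ≠ 0) (hf : Measurable f) (q : ℝ≥0∞) :
    eLpNorm f q (μ.withDensity w) = eLpNorm (fun x => w x ^ recip q * f x) q μ := by
  rcases eq_or_ne q 0 with rfl | h0
  · simp
  rcases eq_or_ne q ∞ with rfl | h
  · simp only [eLpNorm_exponent_top, eLpNormEssSup, enorm_eq_self, recip, ENNReal.inv_top,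
      ENNReal.toReal_zero, ENNReal.rpow_zero, one_mul]
    exact le_antisymm (essSup_mono_measure (withDensity_absolutelyContinuous μ w))
      (essSup_mono_measure (withDensity_absolutelyContinuous' hw.aemeasurable (.of_forall hw0)))
  · have hpos : q.toReal ≠ 0 := (ENNReal.toReal_pos h0 h).ne'
    simp only [eLpNorm_eq_lintegral_rpow_enorm_toReal h0 h, enorm_eq_self,
      ENNReal.mul_rpow_of_nonneg _ _ ENNReal.toReal_nonneg, ← ENNReal.rpow_mul,
      recip_eq_one_div_toReal, one_div, inv_mul_cancel₀ hpos, ENNReal.rpow_one]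
    rw [lintegral_withDensity_eq_lintegral_mul μ hw (hf.pow_const _)]
    rfl

/-- The measure with mass `1 / k` at `j = k - 1`. It turns `k^{1/2 - 1/q} d_k` in `ℓ^q` into
`k^{1/2} d_k` in `L^q`, a function whose `L²` norm is `‖d‖₂` for every `q`. -/
noncomputable def harmonicMeasure : Measure ℕ :=
  Measure.count.withDensity fun j => ENNReal.ofReal (((j + 1 : ℕ) : ℝ)⁻¹)

theorem eLpNorm_restrict_harmonicMeasure (f : ℕ → ℝ≥0∞) (q : ℝ≥0∞) (s : Set ℕ) :
    eLpNorm f q (harmonicMeasure.restrict s) =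
      eLpNorm (fun j : ℕ => ENNReal.ofReal (((j + 1 : ℕ) : ℝ) ^ (-recip q)) * f j) q
        (Measure.count.restrict s) := by
  rw [harmonicMeasure, restrict_withDensity .of_discrete, eLpNorm_withDensity .of_discrete
    (fun j => (ENNReal.ofReal_pos.2 (by positivity)).ne') .of_discrete]
  congr! 3 with j
  rw [ENNReal.ofReal_rpow_of_pos (by positivity), Real.inv_rpow (by positivity),
    Real.rpow_neg (by positivity)]

/-- The indices `j` with `2^{2^i} ≤ j + 2 < 2^{2^{i + 1}}`, on which `1 + log (j + 1) ≈ 2^i`. -/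
def doublyDyadicBlock (i : ℕ) : Set ℕ := (fun j => Nat.log 2 (Nat.log 2 (j + 2))) ⁻¹' {i}

theorem mem_doublyDyadicBlock {i j : ℕ} :
    j ∈ doublyDyadicBlock i ↔ 2 ^ 2 ^ i ≤ j + 2 ∧ j + 2 < 2 ^ 2 ^ (i + 1) := by
  have hlog : Nat.log 2 (j + 2) ≠ 0 := (Nat.log_pos one_lt_two (by omega)).ne'
  rw [← Nat.le_log_iff_pow_le one_lt_two (by omega), ← Nat.log_lt_iff_lt_pow one_lt_two (by omega)]
  exact Nat.log_eq_iff (.inr ⟨one_lt_two, hlog⟩)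

theorem doublyDyadicBlock_subset_Iio (i : ℕ) : doublyDyadicBlock i ⊆ Iio (2 ^ 2 ^ (i + 1)) :=
  fun j hj => by
    have := (mem_doublyDyadicBlock.1 hj).2
    exact mem_Iio.2 (by omega)

theorem one_add_log_comparable {i j : ℕ} (hj : j ∈ doublyDyadicBlock i) :
    1 + Real.log ((j + 1 : ℕ) : ℝ) ≤ 3 * 2 ^ i ∧
      2 ^ i ≤ 3 * (1 + Real.log ((j + 1 : ℕ) : ℝ)) := by
  obtain ⟨h₁, h₂⟩ := mem_doublyDyadicBlock.1 hj
  have hlog_gt := Real.log_two_gt_d9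
  have hlog_lt := Real.log_two_lt_d9
  have hi : (1 : ℝ) ≤ 2 ^ i := one_le_pow₀ one_le_two
  constructor
  · have hle : ((j + 1 : ℕ) : ℝ) ≤ 2 ^ 2 ^ (i + 1) := by
      exact_mod_cast (show j + 1 ≤ 2 ^ 2 ^ (i + 1) by omega)
    have := Real.log_le_log (by positivity) hle
    rw [Real.log_pow] at this
    push_cast [pow_succ] at this ⊢
    nlinarith
  · have hle : (2 : ℝ) ^ 2 ^ i ≤ 2 * ((j + 1 : ℕ) : ℝ) := by
      exact_mod_cast (show 2 ^ 2 ^ i ≤ 2 * (j + 1) by omega)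
    have := Real.log_le_log (by positivity) hle
    rw [Real.log_pow, Real.log_mul two_ne_zero (by positivity)] at this
    push_cast at this ⊢
    nlinarith

theorem harmonicMeasure_doublyDyadicBlock_le (i : ℕ) :
    harmonicMeasure (doublyDyadicBlock i) ≤ 3 * 2 ^ (i : ℝ) := by
  have hi : (1 : ℝ) ≤ 2 ^ i := one_le_pow₀ one_le_two
  calc harmonicMeasure (doublyDyadicBlock i)
      ≤ harmonicMeasure (Finset.range (2 ^ 2 ^ (i + 1)) : Set ℕ) := by
        rw [Finset.coe_range]
        exact measure_mono (doublyDyadicBlock_subset_Iio i)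
    _ = ENNReal.ofReal (harmonic (2 ^ 2 ^ (i + 1)) : ℚ) := by
        rw [harmonicMeasure, withDensity_apply _ .of_discrete, lintegral_finset,
          harmonic, Rat.cast_sum, ENNReal.ofReal_sum_of_nonneg fun _ _ => by positivity]
        simp
    _ ≤ ENNReal.ofReal (3 * 2 ^ i) := by
        refine ENNReal.ofReal_le_ofReal ((harmonic_le_one_add_log _).trans ?_)
        push_cast [Real.log_pow, pow_succ]
        nlinarith [Real.log_two_lt_d9]
    _ = 3 * 2 ^ (i : ℝ) := by
        rw [ENNReal.ofReal_mul (by norm_num), two_rpow_eq_ofReal, Real.rpow_natCast,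
          ENNReal.ofReal_ofNat]

theorem sqrt_mul_le_eLpNorm_two_of_antitone {d : ℕ → ℝ≥0∞} (hd : Antitone d) {j n : ℕ}
    (hj : j < n) :
    ENNReal.ofReal (((j + 1 : ℕ) : ℝ) ^ (1 / 2 : ℝ)) * d j ≤
      eLpNorm d 2 (Measure.count.restrict (Iio n)) := by
  calc ENNReal.ofReal (((j + 1 : ℕ) : ℝ) ^ (1 / 2 : ℝ)) * d j
      = eLpNorm (fun _ : ℕ => d j) 2 (Measure.count.restrict (Iio (j + 1))) := by
        rw [eLpNorm_const' _ two_ne_zero ENNReal.ofNat_ne_top, Measure.restrict_apply_univ,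
          ← Finset.coe_range, Measure.count_apply_finset, Finset.card_range, enorm_eq_self,
          mul_comm, ← ENNReal.ofReal_rpow_of_pos (by positivity), ENNReal.ofReal_natCast,
          ENNReal.toReal_ofNat]
    _ ≤ eLpNorm d 2 (Measure.count.restrict (Iio (j + 1))) := by
        refine eLpNorm_mono_enorm_ae ?_
        filter_upwards [ae_restrict_mem .of_discrete] with k hk
        exact hd (Nat.le_of_lt_succ hk)
    _ ≤ eLpNorm d 2 (Measure.count.restrict (Iio n)) :=
        eLpNorm_mono_measure d (Measure.restrict_mono (Iio_subset_Iio hj) le_rfl)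

theorem eLpNorm_harmonicMeasure_doublyDyadicBlock_le {q : ℝ≥0∞} (hq : q ≠ 0) {d : ℕ → ℝ≥0∞}
    (hd : Antitone d) (i : ℕ) :
    eLpNorm (fun j : ℕ => ENNReal.ofReal (((j + 1 : ℕ) : ℝ) ^ (1 / 2 : ℝ)) * d j) q
        (harmonicMeasure.restrict (doublyDyadicBlock i)) ≤
      eLpNorm d 2 (Measure.count.restrict (Iio (2 ^ 2 ^ (i + 1)))) *
        (3 * 2 ^ (i : ℝ)) ^ (recip q - recip (max q 2)) := by
  have hsub := doublyDyadicBlock_subset_Iio i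
  have hexp : recip (min 2 q) - recip 2 = recip q - recip (max q 2) := by
    linarith [recip_min_add_recip_max 2 q, congrArg recip (max_comm 2 q)]
  have hexp_nonneg : 0 ≤ recip q - recip (max q 2) := sub_nonneg.2 <|
    ENNReal.toReal_mono (by simp [hq]) (ENNReal.inv_le_inv.2 (le_max_left q 2))
  refine (eLpNorm_le_of_eLpNorm_top_le two_ne_zero hq
    Measurable.of_discrete.aestronglyMeasurable
    (A := eLpNorm d 2 (Measure.count.restrict (Iio (2 ^ 2 ^ (i + 1))))) ?_ ?_).trans ?_
  · rw [eLpNorm_restrict_harmonicMeasure]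
    refine (eLpNorm_congr_ae (.of_forall fun j => ?_)).trans_le
      (eLpNorm_mono_measure d (Measure.restrict_mono hsub le_rfl))
    rw [← mul_assoc, ← ENNReal.ofReal_mul (by positivity), ← Real.rpow_add (by positivity)]
    simp [recip_two]
  · rw [eLpNorm_exponent_top]
    refine eLpNormEssSup_le_of_ae_enorm_bound ?_
    filter_upwards [ae_restrict_mem .of_discrete] with j hj
    exact sqrt_mul_le_eLpNorm_two_of_antitone hd (hsub hj)
  · rw [hexp, Measure.restrict_apply_univ]
    gcongr
    exact harmonicMeasure_doublyDyadicBlock_le i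

theorem lzSeqNorm_two_eq_eLpNorm_harmonicMeasure {ι : Type} (q : ℝ≥0∞) (b : ℝ) (c : ι → ℂ) :
    lzSeqNorm 2 q b c = eLpNorm (fun j : ℕ =>
      ENNReal.ofReal ((1 + Real.log ((j + 1 : ℕ) : ℝ)) ^ b) *
        (ENNReal.ofReal (((j + 1 : ℕ) : ℝ) ^ (1 / 2 : ℝ)) * seqRearr c (j + 1))) q
      harmonicMeasure := by
  rw [← Measure.restrict_univ (μ := harmonicMeasure), eLpNorm_restrict_harmonicMeasure,
    Measure.restrict_univ, lzSeqNorm]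
  congr! 2 with j
  rw [sub_eq_neg_add, Real.rpow_add (by positivity), ENNReal.ofReal_mul (by positivity),
    ENNReal.ofReal_mul (by positivity), recip_two]
  ring

theorem exists_lzSeqNorm_two_le {q : ℝ≥0∞} (hq : q ≠ 0) (b : ℝ) :
    ∃ C ≠ ∞, ∀ {ι : Type} (c : ι → ℂ), lzSeqNorm 2 q b c ≤
      C * eLpNorm (fun i : ℕ => 2 ^ (i * (b + recip q - recip (max q 2))) *
        eLpNorm (fun k => seqRearr c (k + 1)) 2 (Measure.count.restrict (Iio (2 ^ 2 ^ (i + 1)))))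
        q Measure.count := by
  set e := recip q - recip (max q 2) with he
  have he_nonneg : 0 ≤ e := sub_nonneg.2 <|
    ENNReal.toReal_mono (by simp [hq]) (ENNReal.inv_le_inv.2 (le_max_left q 2))
  refine ⟨ENNReal.ofReal (3 ^ |b|) * 3 ^ e, ENNReal.mul_ne_top ENNReal.ofReal_ne_top
    (ENNReal.rpow_ne_top_of_nonneg he_nonneg ENNReal.ofNat_ne_top), fun {ι} c => ?_⟩
  set d : ℕ → ℝ≥0∞ := fun k => seqRearr c (k + 1)
  have hd : Antitone d := fun j k hjk => seqRearr_antitone c (Nat.succ_le_succ hjk)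
  set F : ℕ → ℝ≥0∞ := fun j => ENNReal.ofReal (((j + 1 : ℕ) : ℝ) ^ (1 / 2 : ℝ)) * d j
  set L : ℕ → ℝ≥0∞ := fun j => ENNReal.ofReal ((1 + Real.log ((j + 1 : ℕ) : ℝ)) ^ b)
  rw [lzSeqNorm_two_eq_eLpNorm_harmonicMeasure,
    eLpNorm_eq_eLpNorm_count_fiber (b := fun j => Nat.log 2 (Nat.log 2 (j + 2))) .of_discrete]
  refine eLpNorm_le_mul_of_le_mul (fun i => ?_) q
  calc eLpNorm (fun j => L j * F j) q (harmonicMeasure.restrict (doublyDyadicBlock i))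
      ≤ ENNReal.ofReal (3 ^ |b|) * 2 ^ (i * b) *
          eLpNorm F q (harmonicMeasure.restrict (doublyDyadicBlock i)) := by
        refine eLpNorm_le_mul_eLpNorm_of_ae_le_mul'' q
          Measurable.of_discrete.aestronglyMeasurable ?_
        filter_upwards [ae_restrict_mem .of_discrete] with j hj
        obtain ⟨h₁, h₂⟩ := one_add_log_comparable hj
        have : 0 ≤ Real.log ((j + 1 : ℕ) : ℝ) := Real.log_natCast_nonneg _
        simp only [enorm_eq_self]
        gcongr
        rw [two_rpow_eq_ofReal, Real.rpow_mul two_pos.le, Real.rpow_natCast]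
        exact ofReal_rpow_le_of_comparable (by positivity) (by positivity) three_pos h₁ h₂ b
    _ ≤ ENNReal.ofReal (3 ^ |b|) * 2 ^ (i * b) * (eLpNorm d 2
          (Measure.count.restrict (Iio (2 ^ 2 ^ (i + 1)))) * (3 * 2 ^ (i : ℝ)) ^ e) := by
        gcongr
        exact eLpNorm_harmonicMeasure_doublyDyadicBlock_le hq hd i
    _ = ENNReal.ofReal (3 ^ |b|) * 3 ^ e * (2 ^ (i * (b + recip q - recip (max q 2))) *
          eLpNorm d 2 (Measure.count.restrict (Iio (2 ^ 2 ^ (i + 1))))) := by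
        rw [add_sub_assoc, ← he, mul_add, two_rpow_add,
          ENNReal.mul_rpow_of_nonneg _ _ he_nonneg, ← ENNReal.rpow_mul]
        ring

theorem exists_max_lzSeqNorm_le {q : ℝ≥0∞} (hq : q ≠ 0) (α : ℝ) :
    ∃ C ≠ ∞, ∀ {ι : Type} (c : ι → ℂ),
      max (lzSeqNorm 2 q (α + recip (max q 2)) c) (lzSeqNorm 2 (max q 2) (α + recip q) c) ≤
        C * eLpNorm (fun i : ℕ => 2 ^ (i * (α + recip q)) * eLpNorm
          (fun k => seqRearr c (k + 1)) 2 (Measure.count.restrict (Iio (2 ^ 2 ^ (i + 1)))))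
          q Measure.count := by
  obtain ⟨C₁, hC₁, h₁⟩ := exists_lzSeqNorm_two_le hq (α + recip (max q 2))
  obtain ⟨C₂, hC₂, h₂⟩ :=
    exists_lzSeqNorm_two_le (q := max q 2) (hq.bot_lt.trans_le (le_max_left q 2)).ne' (α + recip q)
  refine ⟨max C₁ C₂, (max_lt hC₁.lt_top hC₂.lt_top).ne, fun {ι} c => max_le ?_ ?_⟩
  · refine (h₁ c).trans (mul_le_mul' (le_max_left _ _) (le_of_eq ?_))
    congr! 5
    ring
  · rw [max_eq_left (le_max_right q 2)] at h₂
    refine (h₂ c).trans (mul_le_mul' (le_max_right _ _) ?_)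
    simp only [add_sub_cancel_right]
    simpa only [Measure.restrict_univ] using
      eLpNorm_count_restrict_le_of_le hq (le_max_left q 2) _ univ

end LorentzZygmundSequence

section LevelShells

theorem unitVolume_univ : unitVolume univ = 1 := by
  simp [unitVolume]

instance : IsProbabilityMeasure unitVolume := ⟨unitVolume_univ⟩

theorem funRearr_antitone (f : ℝ →ₘ[unitVolume] ℂ) : Antitone (funRearr f) := fun _ _ hst =>
  sInf_le_sInf fun _ hu => le_trans (α := ℝ≥0∞) hu (ENNReal.ofReal_le_ofReal hst)

theorem measure_funRearr_lt_le (f : ℝ →ₘ[unitVolume] ℂ) (t : ℝ) :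
    unitVolume {x | funRearr f t < ‖f x‖ₑ} ≤ ENNReal.ofReal t := by
  set S : Set ℝ≥0∞ := {s : ℝ≥0∞ | unitVolume {x | s < ‖f x‖ₑ} ≤ ENNReal.ofReal t} with hS
  obtain ⟨u, hu, hlim, hmem⟩ :=
    exists_seq_tendsto_sInf (S := S) ⟨∞, by simp [hS]⟩ (OrderBot.bddBelow S)
  have hsub : {x | funRearr f t < ‖f x‖ₑ} ⊆ ⋃ n, {x | u n < ‖f x‖ₑ} := fun x hx => by
    obtain ⟨n, hn⟩ := (hlim.eventually (gt_mem_nhds (show sInf S < ‖f x‖ₑ from hx))).exists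
    exact mem_iUnion.2 ⟨n, hn⟩
  have hmono : Monotone fun n => {x | u n < ‖f x‖ₑ} := fun m n hmn x hx => (hu hmn).trans_lt hx
  refine (measure_mono hsub).trans ?_
  rw [hmono.measure_iUnion]
  exact iSup_le hmem

theorem funRearr_one (f : ℝ →ₘ[unitVolume] ℂ) : funRearr f 1 = 0 := by
  refine le_antisymm (sInf_le ?_) zero_le
  simpa using prob_le_one

/-- The dyadic samples `2^{-m/2} f^*(2^{-m-1})` of `t^{1/2} f^*(t)`. -/
noncomputable def dyadicRearr (f : ℝ →ₘ[unitVolume] ℂ) (m : ℕ) : ℝ≥0∞ :=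
  2 ^ (-(m : ℝ) / 2) * funRearr f ((1 / 2) ^ (m + 1))

/-- The set on which `f^*(2^{-m}) < |f| ≤ f^*(2^{-m-1})`. -/
def levelShell (f : ℝ →ₘ[unitVolume] ℂ) (m : ℕ) : Set ℝ :=
  {x | funRearr f ((1 / 2) ^ m) < ‖f x‖ₑ ∧ ‖f x‖ₑ ≤ funRearr f ((1 / 2) ^ (m + 1))}

theorem measurableSet_levelShell (f : ℝ →ₘ[unitVolume] ℂ) (m : ℕ) :
    MeasurableSet (levelShell f m) :=
  (measurableSet_lt measurable_const f.measurable.enorm).inter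
    (measurableSet_le f.measurable.enorm measurable_const)

theorem ofReal_half_pow (m : ℕ) : ENNReal.ofReal ((1 / 2) ^ m) = 2 ^ (-(m : ℝ)) := by
  rw [two_rpow_eq_ofReal, Real.rpow_neg two_pos.le, Real.rpow_natCast, one_div, inv_pow]

theorem eLpNorm_levelShell_le (f : ℝ →ₘ[unitVolume] ℂ) (p : ℝ≥0∞) (m : ℕ) :
    eLpNorm f p (unitVolume.restrict (levelShell f m)) ≤
      2 ^ (m * (1 / 2 - recip p)) * dyadicRearr f m := by
  have hmeasure : unitVolume (levelShell f m) ≤ 2 ^ (-(m : ℝ)) :=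
    (measure_mono fun x hx => hx.1).trans
      ((measure_funRearr_lt_le f _).trans_eq (ofReal_half_pow m))
  calc eLpNorm f p (unitVolume.restrict (levelShell f m))
      ≤ funRearr f ((1 / 2) ^ (m + 1)) • unitVolume (levelShell f m) ^ recip p := by
        rw [recip, ENNReal.toReal_inv, ← Measure.restrict_apply_univ (levelShell f m)]
        refine eLpNorm_le_of_ae_enorm_bound ?_
        filter_upwards [ae_restrict_mem (measurableSet_levelShell f m)] with x hx using hx.2
    _ ≤ funRearr f ((1 / 2) ^ (m + 1)) * (2 ^ (-(m : ℝ))) ^ recip p := by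
        rw [smul_eq_mul]
        gcongr
        exact recip_nonneg p
    _ = _ := by
        rw [dyadicRearr, ← mul_assoc, ← two_rpow_add, ← ENNReal.rpow_mul, mul_comm]
        ring_nf

theorem eLpNorm_biUnion_levelShell_le (f : ℝ →ₘ[unitVolume] ℂ) (p : ℝ≥0∞) (I : Set ℕ) :
    eLpNorm f p (unitVolume.restrict (⋃ m ∈ I, levelShell f m)) ≤
      eLpNorm (fun m : ℕ => 2 ^ (m * (1 / 2 - recip p)) * dyadicRearr f m) p
        (Measure.count.restrict I) :=
  (eLpNorm_restrict_biUnion_le _ _ _ _).trans (eLpNorm_mono_enorm (eLpNorm_levelShell_le f p))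

theorem ae_exists_mem_levelShell (f : ℝ →ₘ[unitVolume] ℂ) :
    ∀ᵐ x ∂unitVolume, f x ≠ 0 → ∃ m, x ∈ levelShell f m := by
  have hnull : unitVolume {x | ∀ m : ℕ, funRearr f ((1 / 2) ^ m) < ‖f x‖ₑ} = 0 := by
    have hlim : Filter.Tendsto (fun m : ℕ => ENNReal.ofReal ((1 / 2) ^ m)) .atTop (nhds 0) := by
      simpa using ENNReal.tendsto_ofReal
        (tendsto_pow_atTop_nhds_zero_of_lt_one (r := (1 / 2 : ℝ)) (by norm_num) (by norm_num))
    refine le_antisymm (ge_of_tendsto' hlim fun m => ?_) zero_le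
    exact (measure_mono (ofPred_subset_ofPred.2 fun x hx => hx m)).trans
      (measure_funRearr_lt_le f _)
  filter_upwards [measure_eq_zero_iff_ae_notMem.1 hnull] with x hx hfx
  by_contra! hnot
  refine hx fun m => ?_
  induction m with
  | zero => simpa [funRearr_one] using hfx
  | succ m ih => exact not_le.1 fun hle => hnot m ⟨ih, hle⟩

theorem measurableSet_biUnion_levelShell (f : ℝ →ₘ[unitVolume] ℂ) (I : Set ℕ) :
    MeasurableSet (⋃ m ∈ I, levelShell f m) :=
  .biUnion I.to_countable fun m _ => measurableSet_levelShell f m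

theorem eLpNorm_compl_biUnion_levelShell_le (f : ℝ →ₘ[unitVolume] ℂ) (p : ℝ≥0∞) (I : Set ℕ) :
    eLpNorm f p (unitVolume.restrict (⋃ m ∈ I, levelShell f m)ᶜ) ≤
      eLpNorm f p (unitVolume.restrict (⋃ m ∈ Iᶜ, levelShell f m)) := by
  rw [← eLpNorm_indicator_eq_eLpNorm_restrict (measurableSet_biUnion_levelShell f I).compl,
    ← eLpNorm_indicator_eq_eLpNorm_restrict (measurableSet_biUnion_levelShell f Iᶜ)]
  refine eLpNorm_mono_enorm_ae ?_
  filter_upwards [ae_exists_mem_levelShell f] with x hx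
  by_cases hfx : f x = 0
  · simp [indicator, hfx]
  by_cases hxI : x ∈ ⋃ m ∈ I, levelShell f m
  · rw [indicator_of_notMem (not_not.2 hxI), enorm_zero]
    exact zero_le
  · obtain ⟨m, hm⟩ := hx hfx
    have hmI : m ∈ Iᶜ := fun hmem => hxI (mem_biUnion hmem hm)
    rw [indicator_of_mem hxI, indicator_of_mem (mem_biUnion hmI hm)]

theorem exists_measurableSet_eLpNorm_restrict_le (f : ℝ →ₘ[unitVolume] ℂ) (J : ℕ) :
    ∃ T, MeasurableSet T ∧
      eLpNorm f 2 (unitVolume.restrict T) ≤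
        eLpNorm (dyadicRearr f) 2 (Measure.count.restrict (Iio J)) ∧
      eLpNorm f 1 (unitVolume.restrict Tᶜ) ≤
        2 ^ (-(J : ℝ) / 4) * ∑' m : ℕ, 2 ^ (m * (-1 / 4 : ℝ)) * dyadicRearr f m := by
  refine ⟨_, measurableSet_biUnion_levelShell f (Iio J), ?_, ?_⟩
  · simpa [recip_two] using eLpNorm_biUnion_levelShell_le f 2 (Iio J)
  calc eLpNorm f 1 (unitVolume.restrict (⋃ m ∈ Iio J, levelShell f m)ᶜ)
      ≤ eLpNorm f 1 (unitVolume.restrict (⋃ m ∈ Ici J, levelShell f m)) :=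
        compl_Iio (a := J) ▸ eLpNorm_compl_biUnion_levelShell_le f 1 (Iio J)
    _ ≤ eLpNorm (fun m : ℕ => 2 ^ (m * (1 / 2 - recip 1)) * dyadicRearr f m) 1
          (Measure.count.restrict (Ici J)) := eLpNorm_biUnion_levelShell_le f 1 _
    _ ≤ 2 ^ (-(J : ℝ) / 4) * eLpNorm (fun m : ℕ => 2 ^ (m * (-1 / 4 : ℝ)) * dyadicRearr f m) 1
          (Measure.count.restrict (Ici J)) := by
        refine eLpNorm_le_mul_eLpNorm_of_ae_le_mul'' 1
          Measurable.of_discrete.aestronglyMeasurable ?_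
        filter_upwards [ae_restrict_mem .of_discrete] with m hm
        have hm' : (J : ℝ) ≤ m := by exact_mod_cast mem_Ici.1 hm
        simp only [enorm_eq_self]
        rw [← mul_assoc, ← two_rpow_add]
        gcongr
        · exact one_le_two
        · simp only [recip, inv_one, ENNReal.toReal_one]
          linarith
    _ ≤ 2 ^ (-(J : ℝ) / 4) * ∑' m : ℕ, 2 ^ (m * (-1 / 4 : ℝ)) * dyadicRearr f m := by
        gcongr
        refine (eLpNorm_mono_measure _ Measure.restrict_le_self).trans_eq ?_
        rw [eLpNorm_one_eq_lintegral_enorm, lintegral_count]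
        rfl

end LevelShells

section DyadicSampling

/-- The dyadic interval `(2^{-m-2}, 2^{-m-1})`, on which `t ≈ 2^{-m}`. -/
def dyadicInterval (m : ℕ) : Set ℝ := Ioo ((1 / 2) ^ (m + 2)) ((1 / 2) ^ (m + 1))

theorem dyadicInterval_subset (m : ℕ) : dyadicInterval m ⊆ Ioo 0 1 := fun _ ht =>
  ⟨lt_trans (by positivity) ht.1, ht.2.trans_le (pow_le_one₀ (by norm_num) (by norm_num))⟩

theorem pairwise_disjoint_dyadicInterval : Pairwise (Function.onFun Disjoint dyadicInterval) :=
  (pairwise_disjoint_on _).2 fun m n hmn => disjoint_left.2 fun t hm hn => by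
    have : (1 / 2 : ℝ) ^ (n + 1) ≤ (1 / 2) ^ (m + 2) :=
      pow_le_pow_of_le_one (by norm_num) (by norm_num) (by omega)
    exact (hm.1.trans hn.2).not_ge this

theorem volume_dyadicInterval (m : ℕ) : volume (dyadicInterval m) = 2 ^ (-((m + 2 : ℕ) : ℝ)) := by
  rw [dyadicInterval, Real.volume_Ioo, ← ofReal_half_pow]
  ring_nf

theorem abs_log_bounds_of_mem_dyadicInterval {m : ℕ} {t : ℝ} (ht : t ∈ dyadicInterval m) :
    (m + 1) * Real.log 2 < |Real.log t| ∧ |Real.log t| < (m + 2) * Real.log 2 := by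
  have ht₀ : 0 < t := (dyadicInterval_subset m ht).1
  have lower := Real.log_lt_log (by positivity) ht.1
  have upper := Real.log_lt_log ht₀ ht.2
  rw [Real.log_pow, one_div, Real.log_inv] at lower upper
  push_cast at lower upper
  rw [abs_of_neg (Real.log_neg ht₀ (dyadicInterval_subset m ht).2)]
  constructor <;> linarith

theorem log_weight_le_on_dyadicInterval (γ : ℝ) {m : ℕ} {t : ℝ} (ht : t ∈ dyadicInterval m) :
    ENNReal.ofReal (((m : ℝ) + 1) ^ γ) ≤
      ENNReal.ofReal (3 ^ |γ|) * ENNReal.ofReal ((1 + |Real.log t|) ^ γ) := by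
  obtain ⟨h₁, h₂⟩ := abs_log_bounds_of_mem_dyadicInterval ht
  have hlog_gt := Real.log_two_gt_d9
  have hlog_lt := Real.log_two_lt_d9
  have : (0 : ℝ) ≤ m := m.cast_nonneg
  exact ofReal_rpow_le_of_comparable (by positivity) (by positivity) three_pos
    (by nlinarith) (by nlinarith) γ

theorem power_weight_le_on_dyadicInterval (e : ℝ) {m : ℕ} {t : ℝ} (ht : t ∈ dyadicInterval m) :
    (2 : ℝ≥0∞) ^ (-(m : ℝ) / 2) ≤
      ENNReal.ofReal (4 ^ |1 / 2 - e|) * 2 ^ (-(m : ℝ) * e) * ENNReal.ofReal (t ^ (1 / 2 - e)) := by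
  have ht₀ : 0 < t := (dyadicInterval_subset m ht).1
  obtain ⟨h₁, h₂⟩ := ht
  rw [pow_add] at h₁ h₂
  have hpos : (0 : ℝ) < (1 / 2) ^ m := by positivity
  have hpow : (2 : ℝ) ^ (-(m : ℝ)) = (1 / 2) ^ m := by
    rw [Real.rpow_neg two_pos.le, Real.rpow_natCast, one_div, inv_pow]
  calc (2 : ℝ≥0∞) ^ (-(m : ℝ) / 2)
      = 2 ^ (-(m : ℝ) * e) * ENNReal.ofReal (((1 / 2 : ℝ) ^ m) ^ (1 / 2 - e)) := by
        rw [← hpow, ← Real.rpow_mul two_pos.le, ← two_rpow_eq_ofReal, ← two_rpow_add]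
        ring_nf
    _ ≤ 2 ^ (-(m : ℝ) * e) *
          (ENNReal.ofReal (4 ^ |1 / 2 - e|) * ENNReal.ofReal (t ^ (1 / 2 - e))) := by
        gcongr
        exact ofReal_rpow_le_of_comparable hpos ht₀ four_pos (by linarith) (by linarith) _
    _ = _ := by ring

theorem weighted_dyadicRearr_le_on_dyadicInterval (q : ℝ≥0∞) (γ : ℝ) (f : ℝ →ₘ[unitVolume] ℂ)
    {m : ℕ} {t : ℝ} (ht : t ∈ dyadicInterval m) :
    ENNReal.ofReal (((m : ℝ) + 1) ^ γ) * dyadicRearr f m ≤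
      ENNReal.ofReal (3 ^ |γ|) * ENNReal.ofReal (4 ^ |1 / 2 - recip q|) * 2 ^ (-(m : ℝ) * recip q) *
        (ENNReal.ofReal (t ^ (recip 2 - recip q) * (1 + |Real.log t|) ^ γ) * funRearr f t) := by
  have ht₀ : 0 < t := (dyadicInterval_subset m ht).1
  calc ENNReal.ofReal (((m : ℝ) + 1) ^ γ) * dyadicRearr f m
      ≤ ENNReal.ofReal (3 ^ |γ|) * ENNReal.ofReal ((1 + |Real.log t|) ^ γ) *
          (ENNReal.ofReal (4 ^ |1 / 2 - recip q|) * 2 ^ (-(m : ℝ) * recip q) *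
            ENNReal.ofReal (t ^ (1 / 2 - recip q)) * funRearr f t) := by
        rw [dyadicRearr]
        gcongr
        · exact log_weight_le_on_dyadicInterval γ ht
        · exact power_weight_le_on_dyadicInterval _ ht
        · exact funRearr_antitone f ht.2.le
    _ = _ := by
        rw [recip_two, ENNReal.ofReal_mul (by positivity)]
        ring

theorem weighted_dyadicRearr_le_eLpNorm {q : ℝ≥0∞} (hq : q ≠ 0) (γ : ℝ)
    (f : ℝ →ₘ[unitVolume] ℂ) (m : ℕ) :
    ENNReal.ofReal (((m : ℝ) + 1) ^ γ) * dyadicRearr f m ≤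
      ENNReal.ofReal (3 ^ |γ|) * ENNReal.ofReal (4 ^ |1 / 2 - recip q|) * 2 ^ (2 * recip q) *
        eLpNorm (fun t : ℝ => ENNReal.ofReal (t ^ (recip 2 - recip q) * (1 + |Real.log t|) ^ γ) *
          funRearr f t) q (volume.restrict (dyadicInterval m)) := by
  set K := ENNReal.ofReal (3 ^ |γ|) * ENNReal.ofReal (4 ^ |1 / 2 - recip q|)
  set x := ENNReal.ofReal (((m : ℝ) + 1) ^ γ) * dyadicRearr f m
  set G : ℝ → ℝ≥0∞ := fun t =>
    ENNReal.ofReal (t ^ (recip 2 - recip q) * (1 + |Real.log t|) ^ γ) * funRearr f t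
  have hG : Measurable G := by
    have := (funRearr_antitone f).measurable
    fun_prop
  have hne : volume.restrict (dyadicInterval m) ≠ 0 := by
    rw [Ne, Measure.restrict_eq_zero, volume_dyadicInterval]
    exact (ENNReal.rpow_pos two_pos ENNReal.ofNat_ne_top).ne'
  have hconst : x * 2 ^ (-((m + 2 : ℕ) : ℝ) * recip q) =
      eLpNorm (fun _ : ℝ => x) q (volume.restrict (dyadicInterval m)) := by
    rw [eLpNorm_const _ hq hne, Measure.restrict_apply_univ, volume_dyadicInterval,
      ← ENNReal.rpow_mul, ← recip_eq_one_div_toReal, enorm_eq_self]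
  calc x = 2 ^ (((m + 2 : ℕ) : ℝ) * recip q) * (x * 2 ^ (-((m + 2 : ℕ) : ℝ) * recip q)) := by
        rw [mul_left_comm, ← two_rpow_add, neg_mul, add_neg_cancel, ENNReal.rpow_zero, mul_one]
    _ ≤ 2 ^ (((m + 2 : ℕ) : ℝ) * recip q) * (K * 2 ^ (-(m : ℝ) * recip q) *
          eLpNorm G q (volume.restrict (dyadicInterval m))) := by
        rw [hconst]
        gcongr
        refine eLpNorm_le_mul_eLpNorm_of_ae_le_mul'' q hG.aestronglyMeasurable ?_
        filter_upwards [ae_restrict_mem measurableSet_Ioo] with t ht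
        exact weighted_dyadicRearr_le_on_dyadicInterval q γ f ht
    _ = K * (2 ^ (((m + 2 : ℕ) : ℝ) * recip q) * 2 ^ (-(m : ℝ) * recip q)) *
          eLpNorm G q (volume.restrict (dyadicInterval m)) := by ring
    _ = _ := by
        rw [← two_rpow_add]
        push_cast
        ring_nf

theorem exists_weightedNorm_dyadicRearr_le {q : ℝ≥0∞} (hq : q ≠ 0) (γ : ℝ) :
    ∃ C ≠ ∞, ∀ f : ℝ →ₘ[unitVolume] ℂ,
      weightedNorm q γ (dyadicRearr f) ≤ C * lzFunNorm 2 q γ f := by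
  refine ⟨ENNReal.ofReal (3 ^ |γ|) * ENNReal.ofReal (4 ^ |1 / 2 - recip q|) * 2 ^ (2 * recip q),
    ENNReal.mul_ne_top (ENNReal.mul_ne_top ENNReal.ofReal_ne_top ENNReal.ofReal_ne_top)
      (two_rpow_ne_top _), fun f => ?_⟩
  refine (eLpNorm_le_mul_of_le_mul (weighted_dyadicRearr_le_eLpNorm hq γ f) q).trans ?_
  rw [← eLpNorm_sum_measure,
    ← Measure.restrict_iUnion pairwise_disjoint_dyadicInterval fun _ => measurableSet_Ioo]
  gcongr
  exact eLpNorm_mono_measure _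
    (Measure.restrict_mono (iUnion_subset dyadicInterval_subset) le_rfl)

end DyadicSampling

section Rearrangement

variable {ι : Type}

theorem le_encard_of_lt_seqRearr {c : ι → ℂ} {k : ℕ} {s : ℝ≥0∞} (h : s < seqRearr c k) :
    (k : ℕ∞) ≤ {n | s < ‖c n‖ₑ}.encard :=
  not_lt.1 fun hlt => (notMem_of_lt_csInf' h) hlt

theorem encard_lt_seqRearr_le (c : ι → ℂ) (s : ℝ≥0∞) :
    {k : ℕ | s < seqRearr c (k + 1)}.encard ≤ {n | s < ‖c n‖ₑ}.encard := by
  rcases eq_or_ne {n | s < ‖c n‖ₑ}.encard ⊤ with h | h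
  · simp [h]
  lift {n | s < ‖c n‖ₑ}.encard to ℕ using h with N hN
  have hsub : {k : ℕ | s < seqRearr c (k + 1)} ⊆ (Finset.range N : Set ℕ) := fun k hk => by
    have := hN ▸ le_encard_of_lt_seqRearr hk
    rw [Finset.coe_range, mem_Iio]
    exact_mod_cast this
  refine (encard_le_encard hsub).trans ?_
  rw [encard_coe_eq_coe_finsetCard, Finset.card_range]

theorem seqRearr_add_le {c₀ c₁ : ι → ℂ} {K : ℝ≥0∞} (h : ∀ n, ‖c₁ n‖ₑ ≤ K) (k : ℕ) :
    seqRearr (c₀ + c₁) k ≤ seqRearr c₀ k + K := by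
  rw [← tsub_le_iff_right]
  refine le_sInf fun s hs => ?_
  rw [tsub_le_iff_right]
  refine sInf_le (lt_of_le_of_lt (encard_le_encard fun n hn => ?_) hs)
  refine lt_of_add_lt_add_right (a := K) (lt_of_lt_of_le hn ?_)
  exact (enorm_add_le _ _).trans (by gcongr; exact h n)

theorem seqRearr_le_of_forall_le {c : ι → ℂ} {K : ℝ≥0∞} (h : ∀ n, ‖c n‖ₑ ≤ K) (k : ℕ) :
    seqRearr c (k + 1) ≤ K := by
  have hempty : {n | K < ‖c n‖ₑ} = ∅ := eq_empty_of_forall_notMem fun n hn => (h n).not_gt hn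
  exact sInf_le (by simp [hempty])

theorem tsum_rpow_eq_lintegral_encard_lt {κ : Type*} {d : κ → ℝ≥0∞} (hd : ∀ n, d n ≠ ∞) {p : ℝ}
    (hp : 0 < p) :
    ∑' n, d n ^ p = ENNReal.ofReal p *
      ∫⁻ t in Ioi (0 : ℝ), {n | ENNReal.ofReal t < d n}.encard * ENNReal.ofReal (t ^ (p - 1)) := by
  let _ : MeasurableSpace κ := ⊤
  have hpow (n : κ) : d n ^ p = ENNReal.ofReal ((d n).toReal ^ p) := by
    rw [← ENNReal.ofReal_rpow_of_nonneg ENNReal.toReal_nonneg hp.le, ENNReal.ofReal_toReal (hd n)]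
  simp_rw [hpow]
  rw [← lintegral_count, lintegral_rpow_eq_lintegral_meas_lt_mul _
    (.of_forall fun _ => ENNReal.toReal_nonneg) Measurable.of_discrete.aemeasurable hp]
  congr 1
  refine setLIntegral_congr_fun measurableSet_Ioi fun t ht => ?_
  simp only [Measure.count_apply .of_discrete, ENNReal.ofReal_lt_iff_lt_toReal (le_of_lt ht) (hd _)]

theorem tsum_rpow_seqRearr_le (c : ι → ℂ) {p : ℝ} (hp : 0 < p) :
    ∑' k : ℕ, seqRearr c (k + 1) ^ p ≤ ∑' n, ‖c n‖ₑ ^ p := by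
  rcases eq_or_ne (∑' n, ‖c n‖ₑ ^ p) ∞ with htop | htop
  · exact htop ▸ le_top
  have hbound (n : ι) : ‖c n‖ₑ ≤ (∑' n, ‖c n‖ₑ ^ p) ^ p⁻¹ :=
    (ENNReal.le_rpow_inv_iff hp).2 (ENNReal.le_tsum n)
  have hfin (k : ℕ) : seqRearr c (k + 1) ≠ ∞ := ne_top_of_le_ne_top
    (ENNReal.rpow_ne_top_of_nonneg (by positivity) htop) (seqRearr_le_of_forall_le hbound k)
  rw [tsum_rpow_eq_lintegral_encard_lt hfin hp,
    tsum_rpow_eq_lintegral_encard_lt (fun _ => enorm_ne_top) hp]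
  gcongr with t
  exact_mod_cast encard_lt_seqRearr_le c _

theorem eLpNorm_two_seqRearr_add_le {c₀ c₁ : ι → ℂ} {K : ℝ≥0∞} (h : ∀ n, ‖c₁ n‖ₑ ≤ K) (N : ℕ) :
    eLpNorm (fun k => seqRearr (c₀ + c₁) (k + 1)) 2 (Measure.count.restrict (Iio N)) ≤
      (∑' n, ‖c₀ n‖ₑ ^ (2 : ℝ)) ^ (1 / 2 : ℝ) + (N : ℝ≥0∞) ^ (1 / 2 : ℝ) * K := by
  calc eLpNorm (fun k => seqRearr (c₀ + c₁) (k + 1)) 2 (Measure.count.restrict (Iio N))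
      ≤ eLpNorm ((fun k => seqRearr c₀ (k + 1)) + fun _ => K) 2
          (Measure.count.restrict (Iio N)) := eLpNorm_mono_enorm fun k => seqRearr_add_le h _
    _ ≤ eLpNorm (fun k => seqRearr c₀ (k + 1)) 2 (Measure.count.restrict (Iio N)) +
          eLpNorm (fun _ => K) 2 (Measure.count.restrict (Iio N)) :=
        eLpNorm_add_le Measurable.of_discrete.aestronglyMeasurable
          aestronglyMeasurable_const one_le_two
    _ ≤ (∑' n, ‖c₀ n‖ₑ ^ (2 : ℝ)) ^ (1 / 2 : ℝ) + (N : ℝ≥0∞) ^ (1 / 2 : ℝ) * K := by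
        gcongr
        · refine (eLpNorm_mono_measure _ Measure.restrict_le_self).trans ?_
          rw [eLpNorm_eq_lintegral_rpow_enorm_toReal two_ne_zero ENNReal.ofNat_ne_top,
            lintegral_count, ENNReal.toReal_ofNat]
          gcongr
          exact tsum_rpow_seqRearr_le c₀ two_pos
        · rw [eLpNorm_const' _ two_ne_zero ENNReal.ofNat_ne_top, Measure.restrict_apply_univ,
            ← Finset.coe_range, Measure.count_apply_finset, Finset.card_range, enorm_eq_self,
            mul_comm, ENNReal.toReal_ofNat]

end Rearrangement

section FourierCoefficients

variable {ι : Type} {φ : ι → Lp ℂ 2 unitVolume}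

theorem tsum_enorm_inner_rpow_two_le {𝕜 E κ : Type*} [RCLike 𝕜] [NormedAddCommGroup E]
    [InnerProductSpace 𝕜 E] {v : κ → E} (hv : Orthonormal 𝕜 v) (x : E) :
    ∑' n, ‖inner 𝕜 (v n) x‖ₑ ^ (2 : ℝ) ≤ ‖x‖ₑ ^ (2 : ℝ) := by
  rw [ENNReal.tsum_eq_iSup_sum]
  refine iSup_le fun s => ?_
  have := ENNReal.ofReal_le_ofReal (hv.sum_inner_products_le x (s := s))
  rw [ENNReal.ofReal_sum_of_nonneg (fun _ _ => by positivity)] at this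
  simpa [ENNReal.ofReal_pow, ofReal_norm] using this

theorem enorm_integral_mul_conj_le (g : Lp ℂ 2 unitVolume) {h : ℝ → ℂ}
    (hh : AEStronglyMeasurable h unitVolume) :
    ‖∫ x, h x * (starRingEnd ℂ) (g x) ∂unitVolume‖ₑ ≤
      eLpNorm g ∞ unitVolume * eLpNorm h 1 unitVolume := by
  calc ‖∫ x, h x * (starRingEnd ℂ) (g x) ∂unitVolume‖ₑ
      ≤ ∫⁻ x, ‖h x * (starRingEnd ℂ) (g x)‖ₑ ∂unitVolume := enorm_integral_le_lintegral_enorm _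
    _ = eLpNorm (fun x => h x * (starRingEnd ℂ) (g x)) 1 unitVolume :=
        eLpNorm_one_eq_lintegral_enorm.symm
    _ ≤ eLpNorm g ∞ unitVolume * eLpNorm h 1 unitVolume := by
        refine (eLpNorm_le_eLpNorm_top_mul_eLpNorm 1 (g : ℝ → ℂ) hh
          (fun a b => b * (starRingEnd ℂ) a) 1 (.of_forall fun x => ?_)).trans_eq ?_
        · simp [mul_comm]
        · simp

theorem fourierMap_eq_inner_add {f : ℝ →ₘ[unitVolume] ℂ} {f₀ f₁ : ℝ → ℂ}
    (hφ : ∀ n, eLpNorm (φ n) ∞ unitVolume ≠ ∞) (hf₀ : MemLp f₀ 2 unitVolume)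
    (hf₁ : MemLp f₁ 1 unitVolume) (hf : f =ᵐ[unitVolume] f₀ + f₁) :
    fourierMap φ f = (fun n => inner ℂ (φ n) (hf₀.toLp f₀)) +
      fun n => ∫ x, f₁ x * (starRingEnd ℂ) (φ n x) ∂unitVolume := by
  funext n
  have hconj : MemLp (fun x => (starRingEnd ℂ) (φ n x)) ∞ unitVolume :=
    MemLp.star ⟨Lp.aestronglyMeasurable _, (hφ n).lt_top⟩
  have hinner : inner ℂ (φ n) (hf₀.toLp f₀) =
      ∫ x, f₀ x * (starRingEnd ℂ) (φ n x) ∂unitVolume := by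
    rw [L2.inner_def]
    refine integral_congr_ae ?_
    filter_upwards [hf₀.coeFn_toLp] with x hx
    rw [hx, RCLike.inner_apply]
  have hint {h : ℝ → ℂ} (hh : MemLp h 1 unitVolume) :
      Integrable (fun x => h x * (starRingEnd ℂ) (φ n x)) unitVolume :=
    memLp_one_iff_integrable.1 (hconj.mul hh)
  rw [Pi.add_apply, hinner, fourierMap, ← integral_add (hint (hf₀.mono_exponent one_le_two))
    (hint hf₁)]
  refine integral_congr_ae ?_
  filter_upwards [hf] with x hx
  rw [hx, Pi.add_apply, add_mul]

theorem eLpNorm_two_seqRearr_fourierMap_le (hφ : Orthonormal ℂ φ) {M : ℝ≥0}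
    (hM : ∀ n, eLpNorm (φ n) ∞ unitVolume ≤ M) {f : ℝ →ₘ[unitVolume] ℂ} {f₀ f₁ : ℝ → ℂ}
    (hf₀ : MemLp f₀ 2 unitVolume) (hf₁ : MemLp f₁ 1 unitVolume) (hf : f =ᵐ[unitVolume] f₀ + f₁)
    (N : ℕ) :
    eLpNorm (fun k => seqRearr (fourierMap φ f) (k + 1)) 2 (Measure.count.restrict (Iio N)) ≤
      eLpNorm f₀ 2 unitVolume + (N : ℝ≥0∞) ^ (1 / 2 : ℝ) * (M * eLpNorm f₁ 1 unitVolume) := by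
  have hL1 (n : ι) : ‖∫ x, f₁ x * (starRingEnd ℂ) (φ n x) ∂unitVolume‖ₑ ≤
      M * eLpNorm f₁ 1 unitVolume :=
    (enorm_integral_mul_conj_le (φ n) hf₁.1).trans (by gcongr; exact hM n)
  rw [fourierMap_eq_inner_add (fun n => ne_top_of_le_ne_top ENNReal.coe_ne_top (hM n)) hf₀ hf₁ hf]
  refine (eLpNorm_two_seqRearr_add_le hL1 N).trans ?_
  gcongr
  rw [one_div, ENNReal.rpow_inv_le_iff two_pos, ← Lp.enorm_toLp hf₀]
  exact tsum_enorm_inner_rpow_two_le hφ _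

end FourierCoefficients

section FourierMap

variable {ι : Type} {φ : ι → Lp ℂ 2 unitVolume} {M : ℝ≥0}

theorem integrable_of_tsum_dyadicRearr_ne_top {f : ℝ →ₘ[unitVolume] ℂ}
    (hf : ∑' m : ℕ, 2 ^ (m * (-1 / 4 : ℝ)) * dyadicRearr f m ≠ ∞) :
    Integrable f unitVolume := by
  obtain ⟨T, -, h₀, h₁⟩ := exists_measurableSet_eLpNorm_restrict_le f 0
  have hT₀ : eLpNorm f 2 (unitVolume.restrict T) = 0 := by simpa using h₀
  have hint : IntegrableOn f T unitVolume := MemLp.integrable one_le_two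
    ⟨f.aestronglyMeasurable.restrict, hT₀ ▸ ENNReal.zero_lt_top⟩
  have hint' : IntegrableOn f Tᶜ unitVolume := memLp_one_iff_integrable.1
    ⟨f.aestronglyMeasurable.restrict,
      h₁.trans_lt (ENNReal.mul_lt_top (two_rpow_ne_top _).lt_top hf.lt_top)⟩
  simpa using hint.union hint'

theorem eLpNorm_two_seqRearr_fourierMap_le_dyadicRearr (hφ : Orthonormal ℂ φ)
    (hM : ∀ n, eLpNorm (φ n) ∞ unitVolume ≤ M) {f : ℝ →ₘ[unitVolume] ℂ}
    (hf : ∑' m : ℕ, 2 ^ (m * (-1 / 4 : ℝ)) * dyadicRearr f m ≠ ∞) (J N : ℕ) :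
    eLpNorm (fun k => seqRearr (fourierMap φ f) (k + 1)) 2 (Measure.count.restrict (Iio N)) ≤
      eLpNorm (dyadicRearr f) 2 (Measure.count.restrict (Iio J)) +
        (N : ℝ≥0∞) ^ (1 / 2 : ℝ) * (M * (2 ^ (-(J : ℝ) / 4) *
          ∑' m : ℕ, 2 ^ (m * (-1 / 4 : ℝ)) * dyadicRearr f m)) := by
  rcases eq_or_ne (eLpNorm (dyadicRearr f) 2 (Measure.count.restrict (Iio J))) ∞ with htop | htop
  · simp [htop]
  obtain ⟨T, hT, h₀, h₁⟩ := exists_measurableSet_eLpNorm_restrict_le f J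
  rw [← eLpNorm_indicator_eq_eLpNorm_restrict hT] at h₀
  rw [← eLpNorm_indicator_eq_eLpNorm_restrict hT.compl] at h₁
  have hf₀ : MemLp (T.indicator f) 2 unitVolume :=
    ⟨f.aestronglyMeasurable.indicator hT, h₀.trans_lt htop.lt_top⟩
  have hf₁ : MemLp (Tᶜ.indicator f) 1 unitVolume :=
    ⟨f.aestronglyMeasurable.indicator hT.compl,
      h₁.trans_lt (ENNReal.mul_lt_top (two_rpow_ne_top _).lt_top hf.lt_top)⟩
  refine (eLpNorm_two_seqRearr_fourierMap_le hφ hM hf₀ hf₁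
    (.of_eq (indicator_self_add_compl T f).symm) N).trans ?_
  gcongr

theorem one_le_of_orthonormal_of_eLpNorm_top_le [Nonempty ι] (hφ : Orthonormal ℂ φ)
    (hM : ∀ n, eLpNorm (φ n) ∞ unitVolume ≤ M) : 1 ≤ M := by
  inhabit ι
  have hnorm : eLpNorm (φ default) 2 unitVolume = 1 := by
    rw [← Lp.enorm_def, ← ofReal_norm, hφ.1, ENNReal.ofReal_one]
  have hle : eLpNorm (φ default) 2 unitVolume ≤ M :=
    (eLpNorm_le_eLpNorm_of_exponent_le le_top (Lp.aestronglyMeasurable _)).trans (hM default)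
  exact_mod_cast hnorm ▸ hle

theorem exists_le_two_pow_two_pow {x : ℝ} (hx : 1 ≤ x) :
    ∃ j : ℕ, x ≤ 2 ^ ((2 : ℝ) ^ j) ∧ (2 : ℝ) ^ j ≤ 4 * (1 + Real.log x) := by
  have hlog := Real.log_nonneg hx
  obtain ⟨n, hn, hn'⟩ := exists_nat_pow_near (x := 1 + Real.log x) (y := 2)
    (by linarith) one_lt_two
  refine ⟨n + 2, ?_, by rw [pow_add]; linarith⟩
  rw [← Real.log_le_log_iff (by linarith) (by positivity), Real.log_rpow two_pos, pow_succ]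
  nlinarith [Real.log_two_gt_d9]

theorem two_rpow_scale_mul_le_one {M : ℝ≥0} {j : ℕ} (hj : (M : ℝ) ≤ 2 ^ ((2 : ℝ) ^ j)) (i : ℕ) :
    ((2 ^ 2 ^ (i + 1) : ℕ) : ℝ≥0∞) ^ (1 / 2 : ℝ) *
      (M * 2 ^ (-((2 ^ (i + (j + 4)) - 1 : ℕ) : ℝ) / 4)) ≤ 1 := by
  have hM : (M : ℝ≥0∞) ≤ 2 ^ ((2 : ℝ) ^ j) := by
    rw [two_rpow_eq_ofReal, ← ENNReal.ofReal_coe_nnreal]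
    exact ENNReal.ofReal_le_ofReal hj
  have hN : ((2 ^ 2 ^ (i + 1) : ℕ) : ℝ≥0∞) ^ (1 / 2 : ℝ) = 2 ^ ((2 : ℝ) ^ i) := by
    rw [Nat.cast_pow, Nat.cast_ofNat, ← ENNReal.rpow_natCast, ← ENNReal.rpow_mul]
    congr 1
    push_cast
    ring
  calc _ ≤ (2 : ℝ≥0∞) ^ ((2 : ℝ) ^ i) *
        (2 ^ ((2 : ℝ) ^ j) * 2 ^ (-((2 ^ (i + (j + 4)) - 1 : ℕ) : ℝ) / 4)) := by
        rw [hN]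
        gcongr
    _ = 2 ^ ((2 : ℝ) ^ i + (2 ^ j + -((2 ^ (i + (j + 4)) - 1 : ℕ) : ℝ) / 4)) := by
        rw [two_rpow_add, two_rpow_add]
    _ ≤ 1 := by
        refine ENNReal.rpow_le_one_of_one_le_of_neg one_le_two ?_
        have hi : (1 : ℝ) ≤ 2 ^ i := one_le_pow₀ one_le_two
        have hj' : (1 : ℝ) ≤ 2 ^ j := one_le_pow₀ one_le_two
        rw [Nat.cast_sub Nat.one_le_two_pow]
        push_cast
        rw [pow_add, pow_add]
        nlinarith

theorem exists_scale_eLpNorm_two_seqRearr_fourierMap_le (hφ : Orthonormal ℂ φ)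
    (hM : ∀ n, eLpNorm (φ n) ∞ unitVolume ≤ M) (hM1 : 1 ≤ M) :
    ∃ s : ℕ, (2 : ℝ) ^ s ≤ 64 * (1 + Real.log M) ∧ ∀ f : ℝ →ₘ[unitVolume] ℂ,
      ∑' m : ℕ, 2 ^ (m * (-1 / 4 : ℝ)) * dyadicRearr f m ≠ ∞ → ∀ i : ℕ,
        eLpNorm (fun k => seqRearr (fourierMap φ f) (k + 1)) 2
            (Measure.count.restrict (Iio (2 ^ 2 ^ (i + 1)))) ≤
          eLpNorm (dyadicRearr f) 2 (Measure.count.restrict (Iio (2 ^ (i + s) - 1))) +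
            ∑' m : ℕ, 2 ^ (m * (-1 / 4 : ℝ)) * dyadicRearr f m := by
  obtain ⟨j, hj, hj'⟩ := exists_le_two_pow_two_pow (x := M) (by exact_mod_cast hM1)
  refine ⟨j + 4, by rw [pow_add]; linarith, fun f hf i => ?_⟩
  refine (eLpNorm_two_seqRearr_fourierMap_le_dyadicRearr hφ hM hf (2 ^ (i + (j + 4)) - 1)
    (2 ^ 2 ^ (i + 1))).trans ?_
  gcongr
  rw [← mul_assoc, ← mul_assoc, mul_assoc (_ ^ _)]
  exact mul_le_of_le_one_left' (two_rpow_scale_mul_le_one hj i)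

theorem two_rpow_neg_mul_le {s : ℕ} {b x y : ℝ} (hb : b ≤ 0) (hx : 0 ≤ x) (hy : 0 ≤ y)
    (hs : (2 : ℝ) ^ s ≤ x * y) :
    (2 : ℝ≥0∞) ^ (-(s * b)) ≤ ENNReal.ofReal (x ^ |b|) * ENNReal.ofReal (y ^ |b|) := by
  rw [two_rpow_eq_ofReal, ← ENNReal.ofReal_mul (by positivity), ← Real.mul_rpow hx hy,
    abs_of_nonpos hb, ← mul_neg, Real.rpow_natCast_mul two_pos.le]
  gcongr
  linarith

theorem exists_eLpNorm_fourierMap_le {q : ℝ≥0∞} (hq : q ≠ 0) {α : ℝ} (hα : α + recip q < 0) :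
    ∃ C ≠ ∞, ∀ {ι : Type} {φ : ι → Lp ℂ 2 unitVolume} {M : ℝ≥0}, Orthonormal ℂ φ →
      (∀ n, eLpNorm (φ n) ∞ unitVolume ≤ M) → 1 ≤ M → ∀ f : ℝ →ₘ[unitVolume] ℂ,
      ∑' m : ℕ, 2 ^ (m * (-1 / 4 : ℝ)) * dyadicRearr f m ≠ ∞ →
        eLpNorm (fun i : ℕ => 2 ^ (i * (α + recip q)) *
            eLpNorm (fun k => seqRearr (fourierMap φ f) (k + 1)) 2
              (Measure.count.restrict (Iio (2 ^ 2 ^ (i + 1))))) q Measure.count ≤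
          C * ENNReal.ofReal ((1 + Real.log M) ^ |α + recip q|) *
            weightedNorm q (α + recip (min q 2)) (dyadicRearr f) := by
  obtain ⟨C, hC, h⟩ := exists_eLpNorm_two_initial_add_le hq hα (b := -1 / 4) (by norm_num)
  refine ⟨ENNReal.ofReal (64 ^ |α + recip q|) * C, ENNReal.mul_ne_top ENNReal.ofReal_ne_top hC,
    fun {ι φ M} hφ hM hM1 f hf => ?_⟩
  obtain ⟨s, hs, hle⟩ := exists_scale_eLpNorm_two_seqRearr_fourierMap_le hφ hM hM1
  have hlog : 0 ≤ Real.log M := Real.log_nonneg (by exact_mod_cast hM1)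
  set u : ℕ → ℝ≥0∞ := fun i => eLpNorm (dyadicRearr f) 2 (Measure.count.restrict
    (Iio (2 ^ i - 1))) + ∑' m : ℕ, 2 ^ (m * (-1 / 4 : ℝ)) * dyadicRearr f m
  calc eLpNorm (fun i : ℕ => 2 ^ (i * (α + recip q)) *
        eLpNorm (fun k => seqRearr (fourierMap φ f) (k + 1)) 2
          (Measure.count.restrict (Iio (2 ^ 2 ^ (i + 1))))) q Measure.count
      ≤ eLpNorm (fun i : ℕ => 2 ^ (i * (α + recip q)) * u (i + s)) q Measure.count :=
        eLpNorm_mono_enorm fun i => mul_le_mul_right (hle f hf i) _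
    _ ≤ 2 ^ (-(s * (α + recip q))) *
          eLpNorm (fun i : ℕ => 2 ^ (i * (α + recip q)) * u i) q Measure.count :=
        eLpNorm_two_rpow_mul_comp_add_le u s _ q
    _ ≤ (ENNReal.ofReal (64 ^ |α + recip q|) *
          ENNReal.ofReal ((1 + Real.log M) ^ |α + recip q|)) *
            (C * weightedNorm q (α + recip (min q 2)) (dyadicRearr f)) :=
        mul_le_mul' (two_rpow_neg_mul_le hα.le (by norm_num) (by linarith) hs) (h _)
    _ = _ := by ring

theorem one_add_log_rpow_le {a b x : ℝ} (hab : a ≤ b) (hb : 0 < b) (hx : 1 ≤ x) :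
    (1 + Real.log x) ^ a ≤ (1 + b) ^ b * min x ((1 + Real.log x) ^ b) := by
  have hlog := Real.log_nonneg hx
  have hle : (1 + Real.log x) ^ a ≤ (1 + Real.log x) ^ b :=
    Real.rpow_le_rpow_of_exponent_le (by linarith) hab
  rw [mul_min_of_nonneg _ _ (by positivity)]
  refine hle.trans (le_min ?_ (le_mul_of_one_le_left (by positivity)
    (Real.one_le_rpow (by linarith) hb.le)))
  have hroot : 1 + Real.log x ≤ (1 + b) * x ^ (1 / b) := by
    have h₁ := Real.log_le_rpow_div (zero_le_one.trans hx) (one_div_pos.2 hb)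
    have h₂ := Real.one_le_rpow hx (one_div_pos.2 hb).le
    rw [div_div_eq_mul_div, div_one, mul_comm] at h₁
    linarith
  calc (1 + Real.log x) ^ b ≤ ((1 + b) * x ^ (1 / b)) ^ b := by gcongr
    _ = (1 + b) ^ b * x := by
        rw [Real.mul_rpow (by positivity) (by positivity), ← Real.rpow_mul (by linarith),
          one_div_mul_cancel hb.ne', Real.rpow_one]

end FourierMap

theorem corollary3p6_general {q : ℝ≥0∞} (hq : 0 < q) {α : ℝ} (hα : α < -recip q) :
    ∃ C : ℝ, 0 < C ∧
      ∀ {ι : Type} [Nonempty ι] {φ : ι → Lp ℂ 2 unitVolume} {M : ℝ≥0}, Orthonormal ℂ φ →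
        (∀ n, eLpNorm (φ n) ∞ unitVolume ≤ M) →
        ∀ f ∈ LZFun 2 q (α + recip (min q 2)),
          Integrable f unitVolume ∧
          max (lzSeqNorm 2 q (α + recip (max q 2)) (fourierMap φ f))
              (lzSeqNorm 2 (max q 2) (α + recip q) (fourierMap φ f)) ≤
            ENNReal.ofReal (C * (1 + Real.log M) ^ |α + recip q|) *
              lzFunNorm 2 q (α + recip (min q 2)) f := by
  obtain ⟨C₁, hC₁, hseq⟩ := exists_max_lzSeqNorm_le hq.ne' α
  obtain ⟨C₂, hC₂, hfourier⟩ := exists_eLpNorm_fourierMap_le hq.ne' (α := α) (by linarith)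
  obtain ⟨C₃, hC₃, hfun⟩ := exists_weightedNorm_dyadicRearr_le hq.ne' (α + recip (min q 2))
  obtain ⟨C₄, hC₄, htail⟩ := exists_tsum_two_rpow_mul_le hq.ne' (b := -1 / 4) (by norm_num)
    (α + recip (min q 2))
  have hC : C₁ * C₂ * C₃ ≠ ∞ := ENNReal.mul_ne_top (ENNReal.mul_ne_top hC₁ hC₂) hC₃
  refine ⟨(C₁ * C₂ * C₃).toReal + 1, by positivity, fun {ι _ φ M} hφ hM f hf => ?_⟩
  have htail_ne_top := ne_top_of_le_ne_top (ENNReal.mul_ne_top hC₄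
    (ne_top_of_le_ne_top (ENNReal.mul_ne_top hC₃ (LT.lt.ne hf)) (hfun f))) (htail _)
  have hM1 := one_le_of_orthonormal_of_eLpNorm_top_le hφ hM
  refine ⟨integrable_of_tsum_dyadicRearr_ne_top htail_ne_top, ?_⟩
  set W := ENNReal.ofReal ((1 + Real.log M) ^ |α + recip q|)
  calc _ ≤ C₁ * (C₂ * W * (C₃ * lzFunNorm 2 q (α + recip (min q 2)) f)) :=
        (hseq _).trans (mul_le_mul_right
          ((hfourier hφ hM hM1 f htail_ne_top).trans (mul_le_mul_right (hfun f) _)) _)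
    _ = C₁ * C₂ * C₃ * W * lzFunNorm 2 q (α + recip (min q 2)) f := by ring
    _ ≤ _ := by
        rw [ENNReal.ofReal_mul (by positivity)]
        gcongr
        rw [ENNReal.le_ofReal_iff_toReal_le hC (by positivity)]
        linarith

theorem corollary3p6 (q : ℝ≥0∞) (hq : 0 < q) (α : ℝ) (hα : α < -recip q) :
    ∃ C : ℝ, 0 < C ∧
      ∀ (ι : Type) [Countable ι] [Infinite ι] (φ : ι → Lp ℂ 2 unitVolume) (M : ℝ≥0),
        Orthonormal ℂ φ →
        (⨆ n, eLpNorm (φ n) ∞ unitVolume) = (M : ℝ≥0∞) →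
        ∀ f ∈ LZFun 2 q (α + recip (min q 2)),
          Integrable f unitVolume ∧
          fourierMap φ f ∈
            LZSeq ι 2 q (α + recip (max q 2)) ∩ LZSeq ι 2 (max q 2) (α + recip q) ∧
          max (lzSeqNorm 2 q (α + recip (max q 2)) (fourierMap φ f))
              (lzSeqNorm 2 (max q 2) (α + recip q) (fourierMap φ f)) ≤
            ENNReal.ofReal (C * min (M : ℝ) ((1 + Real.log M) ^ |α|)) *
              lzFunNorm 2 q (α + recip (min q 2)) f := by
  obtain ⟨C, hC, hmain⟩ := corollary3p6_general hq hα
  have hα₀ : |α + recip q| ≤ |α| ∧ 0 < |α| := by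
    have := recip_nonneg q
    rw [abs_of_neg (by linarith), abs_of_neg (by linarith)]
    constructor <;> linarith
  refine ⟨C * (1 + |α|) ^ |α|, by positivity, fun ι _ _ φ M hφ hM f hf => ?_⟩
  have hM' (n : ι) : eLpNorm (φ n) ∞ unitVolume ≤ M :=
    hM ▸ le_iSup (fun n => eLpNorm (φ n) ∞ unitVolume) n
  have hM1 : (1 : ℝ) ≤ M := by exact_mod_cast one_le_of_orthonormal_of_eLpNorm_top_le hφ hM'
  obtain ⟨hint, hbound⟩ := hmain hφ hM' f hf
  replace hbound := hbound.trans (mul_le_mul_left (ENNReal.ofReal_le_ofReal (mul_assoc C _ _ ▸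
    mul_le_mul_of_nonneg_left (one_add_log_rpow_le hα₀.1 hα₀.2 hM1) hC.le)) _)
  have hfin := hbound.trans_lt (ENNReal.mul_lt_top ENNReal.ofReal_lt_top hf)
  exact ⟨hint, ⟨(le_max_left _ _).trans_lt hfin, (le_max_right _ _).trans_lt hfin⟩, hbound⟩
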